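/- **Godbillon–Vey invariance for zero-helicity MHD flows.** Let $\Omega\subset\mathbb R\times\mathbb R^3$ be open, let $\mathbf u$ (the fluid velocity) be a $C^2$ and $\tilde{\mathbf A}$ (the magnetic vector potential) a nowhere vanishing $C^3$ time-dependent vector field on $\Omega$, and put $\mathbf B=\nabla\times\tilde{\mathbf A}$. Assume the ideal MHD Ohm's law $\mathbf E=-\mathbf u\times\mathbf B$ with $\mathbf E=-\nabla\phi_E-\partial_t\tilde{\mathbf A}$ in the gauge $\phi_E=\mathbf u\cdot\tilde{\mathbf A}$, that is, $$\partial_t\tilde{\mathbf A}-\mathbf u\times(\nabla\times\tilde{\mathbf A})+\nabla(\mathbf u\cdot\tilde{\mathbf A})=0\quad\text{on }\Omega,$$ which says that the one-form $\tilde{\mathbf A}\cdot d\mathbf x$ is Lie dragged by the flow, $(\partial_t+\mathcal L_{\mathbf u})(\tilde{\mathbf A}\cdot d\mathbf x)=0$. Assume also that the helicity density vanishes: $\tilde{\mathbf A}\cdot\nabla\times\tilde{\mathbf A}=0$ on $\Omega$. Set $$\boldsymbol\eta=\frac{\tilde{\mathbf A}\times\mathbf B}{|\tilde{\mathbf A}|^2},\qquad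 \psi=\boldsymbol\eta\cdot\nabla\times\boldsymbol\eta,$$ $$\alpha=\frac1{|\tilde{\mathbf A}|^2}\Big\{\tilde{\mathbf A}\cdot\big[\mathbf u\cdot\nabla\boldsymbol\eta+(\nabla\mathbf u)^T\cdot\boldsymbol\eta\big]+\boldsymbol\eta\cdot\big[\mathbf u\cdot\nabla\tilde{\mathbf A}+(\nabla\mathbf u)^T\cdot\tilde{\mathbf A}\big]\Big\},$$ where $\big((\nabla\mathbf u)^T\cdot\mathbf w\big)_i=\sum_j(\partial_iu_j)\,w_j$. Then $\psi$ and $\alpha$ are $C^1$ on $\Omega$ and $$\partial_t\psi+\nabla\cdot(\mathbf u\,\psi+\alpha\mathbf B)=0\quad\text{on }\Omega.$$ Moreover, let $I$ be an open interval, $t_0\in I$, let $D_0\subset\mathbb R^3$ be a bounded open set with $C^1$ boundary, and let $\mathbf x=X(t,\mathbf x_0)$ be the Lagrangian map of $\mathbf u$, i.e. $\partial_tX(t,\mathbf x_0)=\mathbf u(t,X(t,\mathbf x_0))$ and $X(t_0,\mathbf x_0)=\mathbf x_0$, defined with $(t,X(t,\mathbf x_0))\in\Omega$ for $t\in I$,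 $\mathbf x_0\in\overline{D_0}$, and $C^1$ in $(t,\mathbf x_0)$ near $I\times\overline{D_0}$. Put $D(t)=X(t,D_0)$ (the region moving with the fluid) and assume that $\mathbf B\cdot\mathbf n=0$ on $\partial D(t)$ for every $t\in I$, where $\mathbf n$ is the outward unit normal. Then, for every $t\in I$, $\psi$ is integrable over $D(t)$, and the Godbillon–Vey integral $$I^g(t)=\int_{D(t)}\boldsymbol\eta\cdot\nabla\times\boldsymbol\eta\;d^3x$$ satisfies $\dfrac{dI^g}{dt}=0$ on $I$; thus $I^g$ is constant in time. -/

import Mathlib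

open Set Filter Topology MeasureTheory
open scoped ContDiff Gradient RealInnerProductSpace Matrix

/-- Euclidean three-space. -/
abbrev E3 : Type := EuclideanSpace ℝ (Fin 3)

namespace GodbillonVey

noncomputable section

/-- The vector product of `ℝ³`. -/
def cross (a b : E3) : E3 := WithLp.toLp 2 (crossProduct (WithLp.ofLp a) (WithLp.ofLp b))

/-- `pd F j i x` is the partial derivative `∂F_i/∂x_j` at `x`. -/
def pd (F : E3 → E3) (j i : Fin 3) (x : E3) : ℝ :=
  (fderiv ℝ F x (EuclideanSpace.single j 1)) i

/-- `∇ × F`. -/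
def curl (F : E3 → E3) (x : E3) : E3 :=
  !₂[pd F 1 2 x - pd F 2 1 x, pd F 2 0 x - pd F 0 2 x, pd F 0 1 x - pd F 1 0 x]

/-- `∇ · F`. -/
def divergence (F : E3 → E3) (x : E3) : ℝ := ∑ i : Fin 3, pd F i i x

/-- The directional derivative `v · ∇F` at `x`. -/
def convect (v : E3) (F : E3 → E3) (x : E3) : E3 := fderiv ℝ F x v

/-- `(∇u)ᵀ · w` at `x`, the vector with components `∑ⱼ (∂u_j/∂x_i) w_j`. -/
def gradTransposeMul (u : E3 → E3) (w : E3) (x : E3) : E3 :=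
  ContinuousLinearMap.adjoint (fderiv ℝ u x) w

/-- The magnetic field `B = ∇ × A` of a vector potential. -/
def magneticField (A : ℝ → E3 → E3) (t : ℝ) (x : E3) : E3 := curl (A t) x

/-- The electric field `E = -∇φ - ∂A/∂t` of the potentials `φ`, `A`. -/
def electricField (φ : ℝ → E3 → ℝ) (A : ℝ → E3 → E3) (t : ℝ) (x : E3) : E3 :=
  -gradient (φ t) x - deriv (fun s => A s x) t

/-- Ideal Ohm's law `E = -u × B` on the space-time region `Ω`, for the fields derived from
the potentials `φ`, `A`. -/
def IdealOhmLaw (Ω : Set (ℝ × E3)) (u : ℝ → E3 → E3) (φ : ℝ → E3 → ℝ) (A : ℝ → E3 → E3) : Prop :=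
  ∀ t x, (t, x) ∈ Ω → electricField φ A t x = -cross (u t x) (magneticField A t x)

/-- The coefficient vector of the one-form `(∂/∂t + 𝓛_u)(w · dx)`, where by Cartan's formula
`𝓛_u (w · dx) = u ⌟ d(w · dx) + d(u ⌟ (w · dx)) = (-u × (∇ × w) + ∇(u · w)) · dx`. -/
def advectOneForm (u w : ℝ → E3 → E3) (t : ℝ) (x : E3) : E3 :=
  deriv (fun s => w s x) t - cross (u t x) (curl (w t) x)
    + gradient (fun y => ⟪u t y, w t y⟫) x

/-- The one-form `w · dx` is Lie dragged by the flow `u` on the space-time region `Ω`. -/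
def IsLieDragged (Ω : Set (ℝ × E3)) (u w : ℝ → E3 → E3) : Prop :=
  ∀ t x, (t, x) ∈ Ω → advectOneForm u w t x = 0

/-- `η = A × B / |A|²`. -/
def eta (A : ℝ → E3 → E3) (t : ℝ) (x : E3) : E3 :=
  (‖A t x‖ ^ 2)⁻¹ • cross (A t x) (magneticField A t x)

/-- The Godbillon-Vey density `ψ = η · ∇ × η`. -/
def gvDensity (A : ℝ → E3 → E3) (t : ℝ) (x : E3) : ℝ :=
  ⟪eta A t x, curl (eta A t) x⟫

/-- `α = |A|⁻² { A · [u · ∇η + (∇u)ᵀ · η] + η · [u · ∇A + (∇u)ᵀ · A] }`. -/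
def gvAlpha (u A : ℝ → E3 → E3) (t : ℝ) (x : E3) : ℝ :=
  (‖A t x‖ ^ 2)⁻¹ *
    (⟪A t x, convect (u t x) (eta A t) x + gradTransposeMul (u t) (eta A t x) x⟫
      + ⟪eta A t x, convect (u t x) (A t) x + gradTransposeMul (u t) (A t x) x⟫)

/-- The Godbillon-Vey integral of `A` at time `t` over the region `D`. -/
def gvIntegral (A : ℝ → E3 → E3) (D : Set E3) (t : ℝ) : ℝ := ∫ x in D, gvDensity A t x

/-- Near `p`, the region `D` is the side `ρ < 0` of the `C¹` hypersurface `ρ = 0` through `p`. -/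
structure IsLocalDefiningFunction (D : Set E3) (p : E3) (ρ : E3 → ℝ) : Prop where
  contDiffAt : ContDiffAt ℝ 1 ρ p
  apply_eq_zero : ρ p = 0
  gradient_ne_zero : gradient ρ p ≠ 0
  mem_iff : ∀ᶠ x in 𝓝 p, (x ∈ D ↔ ρ x < 0)

/-- A bounded open region with `C¹` boundary. -/
structure IsC1Region (D : Set E3) : Prop where
  isOpen : IsOpen D
  isBounded : Bornology.IsBounded D
  boundary : ∀ p ∈ frontier D, ∃ ρ : E3 → ℝ, IsLocalDefiningFunction D p ρ

/-- `n` is the outward unit normal of `D` at the boundary point `p`. -/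
def IsOutwardUnitNormal (D : Set E3) (p n : E3) : Prop :=
  ∃ ρ : E3 → ℝ, IsLocalDefiningFunction D p ρ ∧ n = ‖gradient ρ p‖⁻¹ • gradient ρ p

/-- The Lagrangian map `x = X t x₀` of the velocity field `u` for the labels in the closure
of `D₀` and the times in `I`, with `x = x₀` at time `t₀`; the trajectories stay in `Ω`, and `X` is
`C¹` in time and label, up to the boundary of `D₀`. -/
structure IsLagrangianMap (Ω : Set (ℝ × E3)) (u : ℝ → E3 → E3) (I : Set ℝ) (t₀ : ℝ)
    (D₀ : Set E3) (X : ℝ → E3 → E3) : Prop where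
  contDiffAt : ∀ t ∈ I, ∀ x₀ ∈ closure D₀, ContDiffAt ℝ 1 (Function.uncurry X) (t, x₀)
  initial : ∀ x₀ ∈ closure D₀, X t₀ x₀ = x₀
  mem : ∀ t ∈ I, ∀ x₀ ∈ closure D₀, (t, X t x₀) ∈ Ω
  hasDerivAt : ∀ t ∈ I, ∀ x₀ ∈ closure D₀, HasDerivAt (fun s => X s x₀) (u t (X t x₀)) t

end

end GodbillonVey

/-! In the language of forms, write 𝓛 for `∂ₜ + 𝓛_u` and d for the spatial exterior derivative; the
two commute. Ohm's law in the given gauge is 𝓛A = 0. Zero helicity gives B = η × A, that is, dA = η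
∧ A (`vort_eq_wedge`). Applying 𝓛 to dA = η ∧ A gives 𝓛η ∧ A = 0, so 𝓛η = αA because A never
vanishes (`lieOne_wedge`). Pairing with A identifies this factor with the stated α (`gvAlpha_mul`).
Applying d instead gives dη ∧ A = 0. Hence 𝓛(η ∧ dη) = αA ∧ dη + η ∧ d(αA) = η ∧ dα ∧ A = -dα ∧ dA =
-d(α dA), which is the conservation law (`conservation_components`, `gv_conservation`).

For the integral, pull back to the fixed domain `D₀`. Liouville's formula for the Jacobian and the
conservation law turn the time derivative into minus the integral of ∇·(αB) over D(t). This vanishes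
by the divergence theorem, since αB is tangent to the boundary. Two analytic points carry the
argument.

The divergence theorem for a tangent field needs no surface measure
(`setIntegral_divergence_smul_eq_zero_of_tangent`). Replace the indicator of D by cut-offs
`smoothStep (n * ρ)` and integrate by parts. The gradients of the cut-offs concentrate where ρ is
small, and there the derivative of ρ along the field is small. Their total mass stays bounded, as
comparison with a constant transversal field shows.

The region D(t) must again have a `C¹` boundary (`IsC1Region.image`). This follows because the flow
map is injective on the closure of `D₀`, by uniqueness for ODEs (`injOn`), and has positive Jacobian
up to the boundary (`det_pos`). -/

namespace GodbillonVey

noncomputable section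

/-! ### Vector calculus in components, as directional derivatives on space-time -/

section Calculus

/-- The derivative of a function of space-time in the direction `v`. -/
def dirD (v : ℝ × E3) (f : ℝ × E3 → ℝ) (p : ℝ × E3) : ℝ := fderiv ℝ f p v

/-- The time direction of space-time. -/
def timeDir : ℝ × E3 := (1, 0)

/-- The `j`-th coordinate direction of space, as a direction of space-time. -/
def spaceDir (j : Fin 3) : ℝ × E3 := (0, EuclideanSpace.single j 1)

/-- The components of a time-dependent vector field, as functions on space-time. -/
def cmp (w : ℝ → E3 → E3) (i : Fin 3) (p : ℝ × E3) : ℝ := w p.1 p.2 i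

variable {f g : ℝ × E3 → ℝ} {p v v' : ℝ × E3} {w : ℝ → E3 → E3} {Ω : Set (ℝ × E3)}

lemma dirD_add (hf : DifferentiableAt ℝ f p) (hg : DifferentiableAt ℝ g p) :
    dirD v (fun q => f q + g q) p = dirD v f p + dirD v g p := by
  simp [dirD, fderiv_fun_add hf hg]

lemma dirD_sub (hf : DifferentiableAt ℝ f p) (hg : DifferentiableAt ℝ g p) :
    dirD v (fun q => f q - g q) p = dirD v f p - dirD v g p := by
  simp [dirD, fderiv_fun_sub hf hg]

lemma dirD_mul (hf : DifferentiableAt ℝ f p) (hg : DifferentiableAt ℝ g p) :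
    dirD v (fun q => f q * g q) p = f p * dirD v g p + dirD v f p * g p := by
  simp [dirD, fderiv_fun_mul hf hg]; ring

lemma dirD_congr (h : f =ᶠ[𝓝 p] g) : dirD v f p = dirD v g p := by
  simp [dirD, h.fderiv_eq]

lemma dirD_const (c : ℝ) : dirD v (fun _ => c) p = 0 := by
  simp [dirD]

lemma _root_.ContDiffOn.dirD {m n : ℕ∞ω} (hf : ContDiffOn ℝ n f Ω) (hΩ : IsOpen Ω)
    (hmn : m + 1 ≤ n) : ContDiffOn ℝ m (dirD v f) Ω :=
  (hf.fderiv_of_isOpen hΩ hmn).clm_apply contDiffOn_const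

lemma dirD_comm (hf : ContDiffAt ℝ 2 f p) :
    GodbillonVey.dirD v (GodbillonVey.dirD v' f) p =
      GodbillonVey.dirD v' (GodbillonVey.dirD v f) p := by
  have hs := hf.isSymmSndFDerivAt (by simp)
  have hd : DifferentiableAt ℝ (fderiv ℝ f) p :=
    (hf.fderiv_right (m := 1) (by norm_num)).differentiableAt (by norm_num)
  have key : ∀ a b : ℝ × E3,
      GodbillonVey.dirD a (GodbillonVey.dirD b f) p = fderiv ℝ (fderiv ℝ f) p a b := by
    intro a b
    have : HasFDerivAt (GodbillonVey.dirD b f) _ p := hd.hasFDerivAt.clm_apply (hasFDerivAt_const b p)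
    rw [GodbillonVey.dirD, this.fderiv]
    simp
  rw [key, key]
  exact hs v v'

lemma _root_.ContDiffOn.cmp {n : ℕ∞ω} (hw : ContDiffOn ℝ n (Function.uncurry w) Ω) (i : Fin 3) :
    ContDiffOn ℝ n (cmp w i) Ω :=
  (contDiffOn_euclidean.1 hw) i

lemma hasFDerivAt_slice {F : Type*} [NormedAddCommGroup F] [NormedSpace ℝ F] {G : ℝ × E3 → F}
    {t : ℝ} {x : E3} (hG : DifferentiableAt ℝ G (t, x)) :
    HasFDerivAt (fun y => G (t, y))
      ((fderiv ℝ G (t, x)).comp (ContinuousLinearMap.inr ℝ ℝ E3)) x :=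
  HasFDerivAt.comp x (f := fun y : E3 => (t, y)) hG.hasFDerivAt (hasFDerivAt_prodMk_right t x)

lemma hasDerivAt_slice {F : Type*} [NormedAddCommGroup F] [NormedSpace ℝ F] {G : ℝ × E3 → F}
    {t : ℝ} {x : E3} (hG : DifferentiableAt ℝ G (t, x)) :
    HasDerivAt (fun s => G (s, x)) (fderiv ℝ G (t, x) (1, 0)) t := by
  have h := HasFDerivAt.comp t (f := fun s : ℝ => (s, x)) hG.hasFDerivAt
    (hasFDerivAt_prodMk_left t x)
  simpa [Function.comp_def] using h.hasDerivAt

lemma dirD_cmp (hw : DifferentiableAt ℝ (Function.uncurry w) p) (i : Fin 3) :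
    dirD v (cmp w i) p = fderiv ℝ (Function.uncurry w) p v i := by
  have h : HasFDerivAt (cmp w i)
      ((EuclideanSpace.proj i : E3 →L[ℝ] ℝ).comp (fderiv ℝ (Function.uncurry w) p)) p :=
    (EuclideanSpace.proj i : E3 →L[ℝ] ℝ).hasFDerivAt.comp p hw.hasFDerivAt
  rw [dirD, h.fderiv]
  simp

lemma pd_eq {t : ℝ} {x : E3} (hw : DifferentiableAt ℝ (Function.uncurry w) (t, x)) (j i : Fin 3) :
    pd (w t) j i x = dirD (spaceDir j) (cmp w i) (t, x) := by
  have h : HasFDerivAt (w t) _ x := hasFDerivAt_slice hw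
  rw [dirD_cmp hw, pd, h.fderiv]
  rfl

lemma deriv_apply_eq {t : ℝ} {x : E3} (hw : DifferentiableAt ℝ (Function.uncurry w) (t, x))
    (i : Fin 3) : deriv (fun s => w s x) t i = dirD timeDir (cmp w i) (t, x) := by
  have h : HasDerivAt (fun s => w s x) _ t := hasDerivAt_slice hw
  rw [dirD_cmp hw, h.deriv]
  rfl

lemma fderiv_apply_eq {t : ℝ} {x : E3} (hw : DifferentiableAt ℝ (Function.uncurry w) (t, x))
    (a : E3) (i : Fin 3) :
    fderiv ℝ (w t) x a i = ∑ j, a j * dirD (spaceDir j) (cmp w i) (t, x) := by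
  have ha : a = ∑ j, a j • EuclideanSpace.single j (1 : ℝ) := by
    ext k; simp [Finset.sum_apply, Pi.single_apply]
  conv_lhs => rw [ha]
  simp only [map_sum, map_smul, ← pd_eq hw, pd]
  simp

lemma inner_gradient {h : E3 → ℝ} {x a : E3} : ⟪gradient h x, a⟫ = fderiv ℝ h x a := by
  rw [gradient, InnerProductSpace.toDual_symm_apply]

lemma gradient_apply_eq {h : ℝ → E3 → ℝ} {t : ℝ} {x : E3}
    (hh : DifferentiableAt ℝ (Function.uncurry h) (t, x)) (i : Fin 3) :
    gradient (h t) x i = dirD (spaceDir i) (Function.uncurry h) (t, x) := by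
  have h1 : gradient (h t) x i = ⟪gradient (h t) x, EuclideanSpace.single i (1 : ℝ)⟫ := by
    rw [EuclideanSpace.inner_single_right]; simp
  have h2 : HasFDerivAt (h t) _ x := hasFDerivAt_slice hh
  rw [h1, inner_gradient, h2.fderiv]
  rfl

lemma gradTransposeMul_apply_eq {t : ℝ} {x : E3}
    (hw : DifferentiableAt ℝ (Function.uncurry w) (t, x)) (a : E3) (i : Fin 3) :
    gradTransposeMul (w t) a x i = ∑ j, a j * dirD (spaceDir i) (cmp w j) (t, x) := by
  have h1 : gradTransposeMul (w t) a x i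
      = ⟪EuclideanSpace.single i (1 : ℝ), gradTransposeMul (w t) a x⟫ := by
    simp [EuclideanSpace.inner_single_left]
  rw [h1, gradTransposeMul, ContinuousLinearMap.adjoint_inner_right]
  simp only [← pd_eq hw, pd, PiLp.inner_apply]
  simp

lemma inner_eq (a b : E3) : ⟪a, b⟫ = a 0 * b 0 + a 1 * b 1 + a 2 * b 2 := by
  simp [PiLp.inner_apply, Fin.sum_univ_three]; ring

lemma norm_sq_eq (a : E3) : ‖a‖ ^ 2 = a 0 * a 0 + a 1 * a 1 + a 2 * a 2 := by
  rw [← real_inner_self_eq_norm_sq, inner_eq]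

@[simp] lemma cross_zero (a b : E3) : cross a b 0 = a 1 * b 2 - a 2 * b 1 := by
  simp [cross, cross_apply]

@[simp] lemma cross_one (a b : E3) : cross a b 1 = a 2 * b 0 - a 0 * b 2 := by
  simp [cross, cross_apply]

@[simp] lemma cross_two (a b : E3) : cross a b 2 = a 0 * b 1 - a 1 * b 0 := by
  simp [cross, cross_apply]

@[simp] lemma curl_zero (F : E3 → E3) (x : E3) : curl F x 0 = pd F 1 2 x - pd F 2 1 x := by
  simp [curl]

@[simp] lemma curl_one (F : E3 → E3) (x : E3) : curl F x 1 = pd F 2 0 x - pd F 0 2 x := by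
  simp [curl]

@[simp] lemma curl_two (F : E3 → E3) (x : E3) : curl F x 2 = pd F 0 1 x - pd F 1 0 x := by
  simp [curl]

lemma contDiffOn_of_cmp {n : ℕ∞ω} (h : ∀ i, ContDiffOn ℝ n (cmp w i) Ω) :
    ContDiffOn ℝ n (Function.uncurry w) Ω :=
  contDiffOn_euclidean.2 h

lemma differentiableAt_uncurry {F : Type*} [NormedAddCommGroup F] [NormedSpace ℝ F]
    {G : ℝ × E3 → F} {n : ℕ∞ω} (hG : ContDiffOn ℝ n G Ω) (hΩ : IsOpen Ω)
    (hn : n ≠ 0) (hp : p ∈ Ω) : DifferentiableAt ℝ G p :=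
  (hG.contDiffAt (hΩ.mem_nhds hp)).differentiableAt hn

lemma contDiffOn_pd {m n : ℕ∞ω} (hw : ContDiffOn ℝ n (Function.uncurry w) Ω) (hΩ : IsOpen Ω)
    (hmn : m + 1 ≤ n) (j i : Fin 3) :
    ContDiffOn ℝ m (fun q : ℝ × E3 => pd (w q.1) j i q.2) Ω :=
  ((hw.cmp i).dirD hΩ hmn (v := spaceDir j)).congr fun q hq => by
    have hn : n ≠ 0 := by rintro rfl; simp at hmn
    exact pd_eq (differentiableAt_uncurry hw hΩ hn hq) j i

lemma contDiffOn_curl {m n : ℕ∞ω} (hw : ContDiffOn ℝ n (Function.uncurry w) Ω) (hΩ : IsOpen Ω)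
    (hmn : m + 1 ≤ n) :
    ContDiffOn ℝ m (Function.uncurry fun t x => curl (w t) x) Ω := by
  have h := fun j i k l => (contDiffOn_pd hw hΩ hmn j i).sub (contDiffOn_pd hw hΩ hmn k l)
  refine contDiffOn_of_cmp fun i => ?_
  fin_cases i
  · exact (h 1 2 2 1).congr fun q _ => by simp [cmp]
  · exact (h 2 0 0 2).congr fun q _ => by simp [cmp]
  · exact (h 0 1 1 0).congr fun q _ => by simp [cmp]

lemma contDiffOn_cross {n : ℕ∞ω} {w' : ℝ → E3 → E3} (hw : ContDiffOn ℝ n (Function.uncurry w) Ω)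
    (hw' : ContDiffOn ℝ n (Function.uncurry w') Ω) :
    ContDiffOn ℝ n (Function.uncurry fun t x => cross (w t x) (w' t x)) Ω := by
  have h := fun i j => (hw.cmp i).mul (hw'.cmp j)
  refine contDiffOn_of_cmp fun i => ?_
  fin_cases i
  · exact ((h 1 2).sub (h 2 1)).congr fun q _ => by simp [cmp]
  · exact ((h 2 0).sub (h 0 2)).congr fun q _ => by simp [cmp]
  · exact ((h 0 1).sub (h 1 0)).congr fun q _ => by simp [cmp]

end Calculus

end

end GodbillonVey
namespace GodbillonVey

noncomputable section

/-! ### Lie derivatives of one-forms and the Godbillon–Vey identity -/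

section LieDerivative

variable {u w A η : ℝ → E3 → E3} {α : ℝ × E3 → ℝ} {p v : ℝ × E3} {Ω : Set (ℝ × E3)}

/-- The components `∂ₜw_i + ∑ⱼ (u_j ∂ⱼw_i + w_j ∂ᵢu_j)` of `(∂ₜ + 𝓛_u) (w · dx)`. -/
def lieOne (u w : ℝ → E3 → E3) (i : Fin 3) (q : ℝ × E3) : ℝ :=
  dirD timeDir (cmp w i) q
    + (cmp u 0 q * dirD (spaceDir 0) (cmp w i) q + cmp w 0 q * dirD (spaceDir i) (cmp u 0) q)
    + (cmp u 1 q * dirD (spaceDir 1) (cmp w i) q + cmp w 1 q * dirD (spaceDir i) (cmp u 1) q)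
    + (cmp u 2 q * dirD (spaceDir 2) (cmp w i) q + cmp w 2 q * dirD (spaceDir i) (cmp u 2) q)

/-- The components `∂ₖw_i - ∂ᵢw_k` of the spatial exterior derivative of `w · dx`. -/
def vort (w : ℝ → E3 → E3) (k i : Fin 3) (q : ℝ × E3) : ℝ :=
  dirD (spaceDir k) (cmp w i) q - dirD (spaceDir i) (cmp w k) q

lemma curl_eq_vort {t : ℝ} {x : E3} (hw : DifferentiableAt ℝ (Function.uncurry w) (t, x)) :
    curl (w t) x 0 = vort w 1 2 (t, x) ∧ curl (w t) x 1 = vort w 2 0 (t, x) ∧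
      curl (w t) x 2 = vort w 0 1 (t, x) := by
  simp [vort, pd_eq hw]

lemma advectOneForm_apply {t : ℝ} {x : E3} (hu : DifferentiableAt ℝ (Function.uncurry u) (t, x))
    (hw : DifferentiableAt ℝ (Function.uncurry w) (t, x)) (i : Fin 3) :
    advectOneForm u w t x i = lieOne u w i (t, x) := by
  have hu' : ∀ i, DifferentiableAt ℝ (cmp u i) (t, x) := differentiableAt_euclidean.1 hu
  have hw' : ∀ i, DifferentiableAt ℝ (cmp w i) (t, x) := differentiableAt_euclidean.1 hw
  have hg : Function.uncurry (fun t y => ⟪u t y, w t y⟫) =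
      fun q => cmp u 0 q * cmp w 0 q + cmp u 1 q * cmp w 1 q + cmp u 2 q * cmp w 2 q := by
    funext q; simp [Function.uncurry, inner_eq, cmp]
  have hm := fun i => (hu' i).fun_mul (hw' i)
  have h1 : gradient (fun y => ⟪u t y, w t y⟫) x i = dirD (spaceDir i)
      (fun q => cmp u 0 q * cmp w 0 q + cmp u 1 q * cmp w 1 q + cmp u 2 q * cmp w 2 q) (t, x) := by
    rw [← hg]
    refine gradient_apply_eq (h := fun t y => ⟪u t y, w t y⟫) ?_ i
    rw [hg]
    exact ((hm 0).fun_add (hm 1)).fun_add (hm 2)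
  rw [dirD_add ((hm 0).fun_add (hm 1)) (hm 2), dirD_add (hm 0) (hm 1), dirD_mul (hu' 0) (hw' 0),
    dirD_mul (hu' 1) (hw' 1), dirD_mul (hu' 2) (hw' 2)] at h1
  obtain ⟨c0, c1, c2⟩ := curl_eq_vort hw
  rw [advectOneForm, PiLp.add_apply, PiLp.sub_apply, h1, deriv_apply_eq hw]
  fin_cases i <;>
  simp only [Fin.zero_eta, Fin.mk_one, Fin.reduceFinMk, cross_zero, cross_one, cross_two,
    c0, c1, c2, vort, lieOne, cmp] <;> ring

/-- The Leibniz expansion is isolated here so that commuting 𝓛 with d reduces to symmetry of second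
derivatives and algebra. -/
lemma dirD_lieOne (hΩ : IsOpen Ω) (hu : ContDiffOn ℝ 2 (Function.uncurry u) Ω)
    (hw : ContDiffOn ℝ 2 (Function.uncurry w) Ω) (hp : p ∈ Ω) (i : Fin 3) :
    dirD v (lieOne u w i) p = dirD v (dirD timeDir (cmp w i)) p
    + (cmp u 0 p * dirD v (dirD (spaceDir 0) (cmp w i)) p
        + dirD v (cmp u 0) p * dirD (spaceDir 0) (cmp w i) p
      + (cmp w 0 p * dirD v (dirD (spaceDir i) (cmp u 0)) p
        + dirD v (cmp w 0) p * dirD (spaceDir i) (cmp u 0) p))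
    + (cmp u 1 p * dirD v (dirD (spaceDir 1) (cmp w i)) p
        + dirD v (cmp u 1) p * dirD (spaceDir 1) (cmp w i) p
      + (cmp w 1 p * dirD v (dirD (spaceDir i) (cmp u 1)) p
        + dirD v (cmp w 1) p * dirD (spaceDir i) (cmp u 1) p))
    + (cmp u 2 p * dirD v (dirD (spaceDir 2) (cmp w i)) p
        + dirD v (cmp u 2) p * dirD (spaceDir 2) (cmp w i) p
      + (cmp w 2 p * dirD v (dirD (spaceDir i) (cmp u 2)) p
        + dirD v (cmp w 2) p * dirD (spaceDir i) (cmp u 2) p)) := by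
  have d1 : ∀ i, DifferentiableAt ℝ (cmp u i) p := fun i =>
    differentiableAt_uncurry (hu.cmp i) hΩ (by norm_num) hp
  have d2 : ∀ i, DifferentiableAt ℝ (cmp w i) p := fun i =>
    differentiableAt_uncurry (hw.cmp i) hΩ (by norm_num) hp
  have d3 : ∀ v i, DifferentiableAt ℝ (dirD v (cmp u i)) p := fun v i =>
    differentiableAt_uncurry ((hu.cmp i).dirD hΩ (m := 1) (by norm_num)) hΩ (by norm_num) hp
  have d4 : ∀ v i, DifferentiableAt ℝ (dirD v (cmp w i)) p := fun v i =>
    differentiableAt_uncurry ((hw.cmp i).dirD hΩ (m := 1) (by norm_num)) hΩ (by norm_num) hp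
  have m1 := fun j => (d1 j).fun_mul (d4 (spaceDir j) i)
  have m2 := fun j => (d2 j).fun_mul (d3 (spaceDir i) j)
  have s := fun j => (m1 j).fun_add (m2 j)
  have e : ∀ j, dirD v (fun q => cmp u j q * dirD (spaceDir j) (cmp w i) q
      + cmp w j q * dirD (spaceDir i) (cmp u j) q) p
      = cmp u j p * dirD v (dirD (spaceDir j) (cmp w i)) p
        + dirD v (cmp u j) p * dirD (spaceDir j) (cmp w i) p
      + (cmp w j p * dirD v (dirD (spaceDir i) (cmp u j)) p
        + dirD v (cmp w j) p * dirD (spaceDir i) (cmp u j) p) := fun j => by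
    rw [dirD_add (m1 j) (m2 j), dirD_mul (d1 j) (d4 _ _), dirD_mul (d2 j) (d3 _ _)]
  unfold lieOne
  rw [dirD_add (((d4 _ _).fun_add (s 0)).fun_add (s 1)) (s 2),
    dirD_add ((d4 _ _).fun_add (s 0)) (s 1), dirD_add (d4 _ _) (s 0), e, e, e]

/-- The operator `∂ₜ + 𝓛_u` commutes with the exterior derivative of one-forms. -/
lemma dirD_lieOne_sub (hΩ : IsOpen Ω) (hu : ContDiffOn ℝ 2 (Function.uncurry u) Ω)
    (hw : ContDiffOn ℝ 2 (Function.uncurry w) Ω) (hp : p ∈ Ω) (k i : Fin 3) :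
    dirD (spaceDir k) (lieOne u w i) p - dirD (spaceDir i) (lieOne u w k) p =
      dirD timeDir (vort w k i) p
      + (cmp u 0 p * dirD (spaceDir 0) (vort w k i) p
        + dirD (spaceDir k) (cmp u 0) p * vort w 0 i p
        + dirD (spaceDir i) (cmp u 0) p * vort w k 0 p)
      + (cmp u 1 p * dirD (spaceDir 1) (vort w k i) p
        + dirD (spaceDir k) (cmp u 1) p * vort w 1 i p
        + dirD (spaceDir i) (cmp u 1) p * vort w k 1 p)
      + (cmp u 2 p * dirD (spaceDir 2) (vort w k i) p
        + dirD (spaceDir k) (cmp u 2) p * vort w 2 i p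
        + dirD (spaceDir i) (cmp u 2) p * vort w k 2 p) := by
  have d4 : ∀ v i, DifferentiableAt ℝ (dirD v (cmp w i)) p := fun v i =>
    differentiableAt_uncurry ((hw.cmp i).dirD hΩ (m := 1) (by norm_num)) hΩ (by norm_num) hp
  have cu : ∀ v v' j, dirD v (dirD v' (cmp u j)) p = dirD v' (dirD v (cmp u j)) p := fun v v' j =>
    dirD_comm ((hu.cmp j).contDiffAt (hΩ.mem_nhds hp))
  have cw : ∀ v v' j, dirD v (dirD v' (cmp w j)) p = dirD v' (dirD v (cmp w j)) p := fun v v' j =>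
    dirD_comm ((hw.cmp j).contDiffAt (hΩ.mem_nhds hp))
  have e : ∀ v, dirD v (vort w k i) p
      = dirD v (dirD (spaceDir k) (cmp w i)) p - dirD v (dirD (spaceDir i) (cmp w k)) p :=
    fun v => dirD_sub (d4 _ _) (d4 _ _)
  rw [dirD_lieOne hΩ hu hw hp, dirD_lieOne hΩ hu hw hp, e, e, e, e,
    cw timeDir (spaceDir k), cw timeDir (spaceDir i),
    cw (spaceDir 0) (spaceDir k), cw (spaceDir 0) (spaceDir i), cw (spaceDir 1) (spaceDir k),
    cw (spaceDir 1) (spaceDir i), cw (spaceDir 2) (spaceDir k), cw (spaceDir 2) (spaceDir i),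
    cu (spaceDir i) (spaceDir k), cu (spaceDir i) (spaceDir k), cu (spaceDir i) (spaceDir k)]
  simp only [vort]
  ring

/-- This is d ∘ d = 0, from symmetry of second derivatives. For A it gives both ∇·B = 0 and, through
dA = η ∧ A, the relation A · ∇ × η = 0. -/
lemma vort_div (hΩ : IsOpen Ω) (hw : ContDiffOn ℝ 2 (Function.uncurry w) Ω) (hp : p ∈ Ω) :
    dirD (spaceDir 0) (vort w 1 2) p + dirD (spaceDir 1) (vort w 2 0) p
      + dirD (spaceDir 2) (vort w 0 1) p = 0 := by
  have d4 : ∀ v i, DifferentiableAt ℝ (dirD v (cmp w i)) p := fun v i =>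
    differentiableAt_uncurry ((hw.cmp i).dirD hΩ (m := 1) (by norm_num)) hΩ (by norm_num) hp
  have cw : ∀ v v' j, dirD v (dirD v' (cmp w j)) p = dirD v' (dirD v (cmp w j)) p := fun v v' j =>
    dirD_comm ((hw.cmp j).contDiffAt (hΩ.mem_nhds hp))
  have e : ∀ v k i, dirD v (vort w k i) p
      = dirD v (dirD (spaceDir k) (cmp w i)) p - dirD v (dirD (spaceDir i) (cmp w k)) p :=
    fun v k i => dirD_sub (d4 _ _) (d4 _ _)
  rw [e, e, e, cw (spaceDir 0) (spaceDir 1), cw (spaceDir 2) (spaceDir 0),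
    cw (spaceDir 2) (spaceDir 1)]
  ring

/-- The relation dA = η ∧ A holds on an open set, so it may be differentiated by the product rule.
-/
lemma dirD_wedge (hΩ : IsOpen Ω) (hA : ContDiffOn ℝ 2 (Function.uncurry A) Ω)
    (hη : ContDiffOn ℝ 2 (Function.uncurry η) Ω)
    (hB : ∀ q ∈ Ω, ∀ k i, vort A k i q = cmp η k q * cmp A i q - cmp η i q * cmp A k q)
    (hp : p ∈ Ω) (k i : Fin 3) :
    dirD v (vort A k i) p = (cmp η k p * dirD v (cmp A i) p + dirD v (cmp η k) p * cmp A i p)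
      - (cmp η i p * dirD v (cmp A k) p + dirD v (cmp η i) p * cmp A k p) := by
  have d1 : ∀ i, DifferentiableAt ℝ (cmp A i) p := fun i =>
    differentiableAt_uncurry (hA.cmp i) hΩ (by norm_num) hp
  have d2 : ∀ i, DifferentiableAt ℝ (cmp η i) p := fun i =>
    differentiableAt_uncurry (hη.cmp i) hΩ (by norm_num) hp
  rw [dirD_congr (g := fun q => cmp η k q * cmp A i q - cmp η i q * cmp A k q),
    dirD_sub ((d2 k).fun_mul (d1 i)) ((d2 i).fun_mul (d1 k)), dirD_mul (d2 k) (d1 i),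
    dirD_mul (d2 i) (d1 k)]
  filter_upwards [hΩ.mem_nhds hp] with q hq using hB q hq k i

/-- If `w · dx` is Lie dragged and its exterior derivative is `η ∧ w`, then the Lie derivative of
`η · dx` is parallel to `w · dx`. -/
lemma lieOne_wedge (hΩ : IsOpen Ω) (hu : ContDiffOn ℝ 2 (Function.uncurry u) Ω)
    (hA : ContDiffOn ℝ 2 (Function.uncurry A) Ω) (hη : ContDiffOn ℝ 2 (Function.uncurry η) Ω)
    (hLA : ∀ q ∈ Ω, ∀ i, lieOne u A i q = 0)
    (hB : ∀ q ∈ Ω, ∀ k i, vort A k i q = cmp η k q * cmp A i q - cmp η i q * cmp A k q)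
    (hp : p ∈ Ω) (k i : Fin 3) :
    lieOne u η k p * cmp A i p = lieOne u η i p * cmp A k p := by
  have h0 : ∀ v i, dirD v (lieOne u A i) p = 0 := fun v i => by
    rw [dirD_congr (g := fun _ => 0), dirD_const]
    filter_upwards [hΩ.mem_nhds hp] with q hq using hLA q hq i
  have key := dirD_lieOne_sub hΩ hu hA hp k i
  rw [h0, h0] at key
  simp only [dirD_wedge hΩ hA hη hB hp, hB p hp] at key
  have l1 := hLA p hp k
  have l2 := hLA p hp i
  simp only [lieOne] at l1 l2 ⊢
  -- 0 = d(𝓛A) = 𝓛(η ∧ A) = 𝓛η ∧ A + η ∧ 𝓛A: `key` is the middle equality in components, and `l1`,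
  -- `l2` remove the last term.
  linear_combination (-1 : ℝ) * key - cmp η k p * l2 + cmp η i p * l1

/-- The conservation law for the Godbillon-Vey density of `dA = η ∧ A` when `A · dx` is Lie dragged
and `(∂ₜ + 𝓛_u) η = α A`, in components. -/
lemma conservation_components (hΩ : IsOpen Ω) (hu : ContDiffOn ℝ 2 (Function.uncurry u) Ω)
    (hA : ContDiffOn ℝ 2 (Function.uncurry A) Ω) (hη : ContDiffOn ℝ 2 (Function.uncurry η) Ω)
    (hα : ContDiffOn ℝ 1 α Ω)
    (hLη : ∀ q ∈ Ω, ∀ i, lieOne u η i q = α q * cmp A i q)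
    (hB : ∀ q ∈ Ω, ∀ k i, vort A k i q = cmp η k q * cmp A i q - cmp η i q * cmp A k q)
    {ψ : ℝ × E3 → ℝ} (hψ : ∀ q ∈ Ω, ψ q = cmp η 0 q * vort η 1 2 q + cmp η 1 q * vort η 2 0 q
      + cmp η 2 q * vort η 0 1 q)
    (hp : p ∈ Ω) :
    dirD timeDir ψ p
      + (dirD (spaceDir 0) (fun q => ψ q * cmp u 0 q + α q * vort A 1 2 q) p
        + dirD (spaceDir 1) (fun q => ψ q * cmp u 1 q + α q * vort A 2 0 q) p
        + dirD (spaceDir 2) (fun q => ψ q * cmp u 2 q + α q * vort A 0 1 q) p) = 0 := by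
  have du : ∀ i, DifferentiableAt ℝ (cmp u i) p := fun i =>
    differentiableAt_uncurry (hu.cmp i) hΩ (by norm_num) hp
  have dA : ∀ i, DifferentiableAt ℝ (cmp A i) p := fun i =>
    differentiableAt_uncurry (hA.cmp i) hΩ (by norm_num) hp
  have dη : ∀ i, DifferentiableAt ℝ (cmp η i) p := fun i =>
    differentiableAt_uncurry (hη.cmp i) hΩ (by norm_num) hp
  have dα : DifferentiableAt ℝ α p := differentiableAt_uncurry hα hΩ (by norm_num) hp
  have dvA : ∀ k i, DifferentiableAt ℝ (vort A k i) p := fun k i =>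
    (differentiableAt_uncurry ((hA.cmp i).dirD hΩ (m := 1) (by norm_num)) hΩ (by norm_num) hp).sub
    (differentiableAt_uncurry ((hA.cmp k).dirD hΩ (m := 1) (by norm_num)) hΩ (by norm_num) hp)
  have dvη : ∀ k i, DifferentiableAt ℝ (vort η k i) p := fun k i =>
    (differentiableAt_uncurry ((hη.cmp i).dirD hΩ (m := 1) (by norm_num)) hΩ (by norm_num) hp).sub
    (differentiableAt_uncurry ((hη.cmp k).dirD hΩ (m := 1) (by norm_num)) hΩ (by norm_num) hp)
  have hψ' : ψ =ᶠ[𝓝 p] fun q => cmp η 0 q * vort η 1 2 q + cmp η 1 q * vort η 2 0 q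
      + cmp η 2 q * vort η 0 1 q := by
    filter_upwards [hΩ.mem_nhds hp] with q hq using hψ q hq
  have m0 := (dη 0).fun_mul (dvη 1 2)
  have m1 := (dη 1).fun_mul (dvη 2 0)
  have m2 := (dη 2).fun_mul (dvη 0 1)
  have dψ : DifferentiableAt ℝ ψ p :=
    hψ'.differentiableAt_iff.2 ((m0.fun_add m1).fun_add m2)
  have eψ : ∀ v, dirD v ψ p = (cmp η 0 p * dirD v (vort η 1 2) p + dirD v (cmp η 0) p * vort η 1 2 p)
      + (cmp η 1 p * dirD v (vort η 2 0) p + dirD v (cmp η 1) p * vort η 2 0 p)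
      + (cmp η 2 p * dirD v (vort η 0 1) p + dirD v (cmp η 2) p * vort η 0 1 p) := fun v => by
    rw [dirD_congr hψ', dirD_add (m0.fun_add m1) m2, dirD_add m0 m1, dirD_mul (dη 0) (dvη 1 2),
      dirD_mul (dη 1) (dvη 2 0), dirD_mul (dη 2) (dvη 0 1)]
  have edψ : ∀ j k i, dirD (spaceDir j) (fun q => ψ q * cmp u j q + α q * vort A k i q) p
      = ψ p * dirD (spaceDir j) (cmp u j) p + dirD (spaceDir j) ψ p * cmp u j p
        + (α p * dirD (spaceDir j) (vort A k i) p + dirD (spaceDir j) α p * vort A k i p) :=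
    fun j k i => by
      rw [dirD_add (dψ.fun_mul (du j)) (dα.fun_mul (dvA k i)), dirD_mul dψ (du j),
        dirD_mul dα (dvA k i)]
  have e : ∀ v i, dirD v (lieOne u η i) p = α p * dirD v (cmp A i) p + dirD v α p * cmp A i p :=
    fun v i => by
      rw [dirD_congr (g := fun q => α q * cmp A i q), dirD_mul dα (dA i)]
      filter_upwards [hΩ.mem_nhds hp] with q hq using hLη q hq i
  have hdiv := vort_div hΩ hA hp
  -- 0 = d(dA) = dη ∧ A - η ∧ dA, and η ∧ dA = η ∧ η ∧ A = 0.
  have hAC : cmp A 0 p * vort η 1 2 p + cmp A 1 p * vort η 2 0 p + cmp A 2 p * vort η 0 1 p = 0 := by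
    have hd := hdiv
    simp only [dirD_wedge hΩ hA hη hB hp] at hd
    have b0 := hB p hp 1 2
    have b1 := hB p hp 2 0
    have b2 := hB p hp 0 1
    simp only [vort] at b0 b1 b2 ⊢
    linear_combination hd + cmp η 0 p * b0 + cmp η 1 p * b1 + cmp η 2 p * b2
  have k0 := dirD_lieOne_sub hΩ hu hη hp 1 2
  have k1 := dirD_lieOne_sub hΩ hu hη hp 2 0
  have k2 := dirD_lieOne_sub hΩ hu hη hp 0 1
  have anti : ∀ k i, vort η k i p = - vort η i k p := fun k i => by simp [vort]
  have diag : ∀ i, vort η i i p = 0 := fun i => by simp [vort]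
  rw [e, e] at k0 k1 k2
  simp only [diag, anti 2 1, anti 0 2, anti 1 0] at k0 k1 k2
  have l0 := hLη p hp 0
  have l1 := hLη p hp 1
  have l2 := hLη p hp 2
  have b0 := hB p hp 1 2
  have b1 := hB p hp 2 0
  have b2 := hB p hp 0 1
  have b0' := b0
  have b1' := b1
  have b2' := b2
  simp only [vort] at b0' b1' b2'
  rw [edψ, edψ, edψ, eψ, eψ, eψ, eψ, hψ p hp, b0, b1, b2]
  simp only [lieOne] at l0 l1 l2
  -- `l0`, `l1`, `l2` give 𝓛η ∧ dη = αA ∧ dη, which `hAC` kills; `k0`, `k1`, `k2` give η ∧ 𝓛dη = η ∧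
  -- d(αA); the primed relations give α η ∧ dA = 0; `hdiv` removes α∇·B. The remaining term η ∧ dα ∧
  -- A cancels against B · ∇α.
  linear_combination α p * hdiv + α p * hAC + vort η 1 2 p * l0 + vort η 2 0 p * l1
    + vort η 0 1 p * l2 - cmp η 0 p * k0 - cmp η 1 p * k1 - cmp η 2 p * k2
    + α p * (cmp η 0 p * b0' + cmp η 1 p * b1' + cmp η 2 p * b2')

end LieDerivative

end

end GodbillonVey
namespace GodbillonVey

noncomputable section

/-! ### From Ohm's law and zero helicity to the conservation law -/

section Conservation

variable {u w A : ℝ → E3 → E3} {φ : ℝ → E3 → ℝ} {Ω : Set (ℝ × E3)}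

/-- With the gauge φ = u · A, Ohm's law is the negative of the Lie dragging equation. The gauge
identity holds on a neighbourhood of each point, so it passes to gradients. -/
lemma isLieDragged_of_idealOhmLaw (hΩ : IsOpen Ω) (hOhm : IdealOhmLaw Ω u φ A)
    (hgauge : ∀ t x, (t, x) ∈ Ω → φ t x = ⟪u t x, A t x⟫) : IsLieDragged Ω u A := by
  intro t x hx
  have h := hOhm t x hx
  have hg : gradient (φ t) x = gradient (fun y => ⟪u t y, A t y⟫) x := by
    have : φ t =ᶠ[𝓝 x] fun y => ⟪u t y, A t y⟫ := by
      have hc : ContinuousAt (fun y : E3 => (t, y)) x := by fun_prop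
      filter_upwards [hc (hΩ.mem_nhds hx)] with y hy using hgauge t y hy
    rw [gradient, gradient, this.fderiv_eq]
  rw [electricField, hg, magneticField] at h
  rw [advectOneForm, ← neg_eq_zero, ← sub_eq_zero.2 h]
  abel

lemma contDiffOn_lieOne (hΩ : IsOpen Ω) (hu : ContDiffOn ℝ 2 (Function.uncurry u) Ω)
    (hw : ContDiffOn ℝ 2 (Function.uncurry w) Ω) (i : Fin 3) : ContDiffOn ℝ 1 (lieOne u w i) Ω := by
  have u1 := fun j => (hu.cmp j).of_le (m := 1) (by norm_num)
  have w1 := fun j => (hw.cmp j).of_le (m := 1) (by norm_num)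
  have du := fun v j => (hu.cmp j).dirD hΩ (m := 1) (v := v) (by norm_num)
  have dw := fun v j => (hw.cmp j).dirD hΩ (m := 1) (v := v) (by norm_num)
  have s := fun j => ((u1 j).mul (dw (spaceDir j) i)).add ((w1 j).mul (du (spaceDir i) j))
  exact (((dw _ _).add (s 0)).add (s 1)).add (s 2)

lemma contDiffOn_eta (hΩ : IsOpen Ω) (hA : ContDiffOn ℝ 3 (Function.uncurry A) Ω)
    (hA0 : ∀ t x, (t, x) ∈ Ω → A t x ≠ 0) : ContDiffOn ℝ 2 (Function.uncurry (eta A)) Ω := by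
  have h2 : ContDiffOn ℝ 2 (Function.uncurry A) Ω := hA.of_le (by norm_num)
  have hB := contDiffOn_curl hA hΩ (m := 2) (by norm_num)
  refine ContDiffOn.smul (f := fun q => (‖Function.uncurry A q‖ ^ 2)⁻¹) ?_ (contDiffOn_cross h2 hB)
  refine (h2.norm_sq ℝ).inv fun q hq => ?_
  have := hA0 q.1 q.2 hq
  simpa [Function.uncurry] using this

lemma contDiffOn_gvDensity (hΩ : IsOpen Ω) (hA : ContDiffOn ℝ 3 (Function.uncurry A) Ω)
    (hA0 : ∀ t x, (t, x) ∈ Ω → A t x ≠ 0) :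
    ContDiffOn ℝ 1 (Function.uncurry (gvDensity A)) Ω := by
  have hη := contDiffOn_eta hΩ hA hA0
  exact (hη.of_le (by norm_num)).inner ℝ (contDiffOn_curl hη hΩ (m := 1) (by norm_num))

lemma norm_sq_mul_eta (hA0 : ∀ t x, (t, x) ∈ Ω → A t x ≠ 0) {q : ℝ × E3} (hq : q ∈ Ω) (i : Fin 3) :
    (cmp A 0 q * cmp A 0 q + cmp A 1 q * cmp A 1 q + cmp A 2 q * cmp A 2 q) * cmp (eta A) i q
      = cross (A q.1 q.2) (magneticField A q.1 q.2) i := by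
  have h : ‖A q.1 q.2‖ ^ 2 ≠ 0 := by simpa using hA0 q.1 q.2 hq
  have := norm_sq_eq (A q.1 q.2)
  simp only [cmp, ← this, eta, PiLp.smul_apply, smul_eq_mul]
  exact mul_inv_cancel_left₀ h _

lemma inner_A_eta (A : ℝ → E3 → E3) (q : ℝ × E3) : cmp A 0 q * cmp (eta A) 0 q
    + cmp A 1 q * cmp (eta A) 1 q + cmp A 2 q * cmp (eta A) 2 q = 0 := by
  simp [cmp, eta]; ring

/-- The double product (A × B) × A equals |A|²B - (A · B)A, and the last term vanishes with the
helicity, so B = η × A. The identity is proved after multiplying by |A|² to avoid division. -/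
lemma vort_eq_wedge (hΩ : IsOpen Ω) (hA : ContDiffOn ℝ 3 (Function.uncurry A) Ω)
    (hA0 : ∀ t x, (t, x) ∈ Ω → A t x ≠ 0)
    (hhelicity : ∀ t x, (t, x) ∈ Ω → ⟪A t x, curl (A t) x⟫ = 0) {q : ℝ × E3} (hq : q ∈ Ω)
    (k i : Fin 3) :
    vort A k i q = cmp (eta A) k q * cmp A i q - cmp (eta A) i q * cmp A k q := by
  obtain ⟨c0, c1, c2⟩ := curl_eq_vort (t := q.1) (x := q.2)
    (differentiableAt_uncurry hA hΩ (by norm_num) hq)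
  have hN : cmp A 0 q * cmp A 0 q + cmp A 1 q * cmp A 1 q + cmp A 2 q * cmp A 2 q ≠ 0 := by
    have h : ‖A q.1 q.2‖ ^ 2 ≠ 0 := by simpa using hA0 q.1 q.2 hq
    rwa [norm_sq_eq] at h
  have e := norm_sq_mul_eta hA0 hq
  have e0 := e 0
  have e1 := e 1
  have e2 := e 2
  have hh := hhelicity q.1 q.2 hq
  rw [inner_eq, c0, c1, c2] at hh
  simp only [magneticField, cross_zero, cross_one, cross_two, c0, c1, c2] at e0 e1 e2
  change A q.1 q.2 0 * vort A 1 2 q + A q.1 q.2 1 * vort A 2 0 q + A q.1 q.2 2 * vort A 0 1 q = 0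
    at hh
  change _ = A q.1 q.2 1 * vort A 0 1 q - A q.1 q.2 2 * vort A 2 0 q at e0
  change _ = A q.1 q.2 2 * vort A 1 2 q - A q.1 q.2 0 * vort A 0 1 q at e1
  change _ = A q.1 q.2 0 * vort A 2 0 q - A q.1 q.2 1 * vort A 1 2 q at e2
  have anti : ∀ k i, vort A k i q = - vort A i k q := fun k i => by simp [vort]
  have diag : ∀ i, vort A i i q = 0 := fun i => by simp [vort]
  apply mul_left_cancel₀ hN
  have b0 : (cmp A 0 q * cmp A 0 q + cmp A 1 q * cmp A 1 q + cmp A 2 q * cmp A 2 q)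
      * vort A 1 2 q = (cmp A 0 q * cmp A 0 q + cmp A 1 q * cmp A 1 q + cmp A 2 q * cmp A 2 q)
      * (cmp (eta A) 1 q * cmp A 2 q - cmp (eta A) 2 q * cmp A 1 q) := by
    simp only [cmp] at *
    linear_combination A q.1 q.2 0 * hh - A q.1 q.2 2 * e1 + A q.1 q.2 1 * e2
  have b1 : (cmp A 0 q * cmp A 0 q + cmp A 1 q * cmp A 1 q + cmp A 2 q * cmp A 2 q)
      * vort A 2 0 q = (cmp A 0 q * cmp A 0 q + cmp A 1 q * cmp A 1 q + cmp A 2 q * cmp A 2 q)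
      * (cmp (eta A) 2 q * cmp A 0 q - cmp (eta A) 0 q * cmp A 2 q) := by
    simp only [cmp] at *
    linear_combination A q.1 q.2 1 * hh - A q.1 q.2 0 * e2 + A q.1 q.2 2 * e0
  have b2 : (cmp A 0 q * cmp A 0 q + cmp A 1 q * cmp A 1 q + cmp A 2 q * cmp A 2 q)
      * vort A 0 1 q = (cmp A 0 q * cmp A 0 q + cmp A 1 q * cmp A 1 q + cmp A 2 q * cmp A 2 q)
      * (cmp (eta A) 0 q * cmp A 1 q - cmp (eta A) 1 q * cmp A 0 q) := by
    simp only [cmp] at *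
    linear_combination A q.1 q.2 2 * hh - A q.1 q.2 1 * e0 + A q.1 q.2 0 * e1
  -- By antisymmetry the nine cases reduce to the three components `b0`, `b1`, `b2` or are trivial.
  fin_cases k <;> fin_cases i <;>
    simp only [Fin.zero_eta, Fin.mk_one, Fin.reduceFinMk, diag, anti 1 0, anti 2 1, anti 0 2] <;>
    first
    | linear_combination b0 | linear_combination -b0 | linear_combination b1
    | linear_combination -b1 | linear_combination b2 | linear_combination -b2
    | ring

/-- The definition of α contains no time derivatives. Since A · η = 0 identically, A · ∂ₜη = -η ·
∂ₜA, and 𝓛A = 0 expresses ∂ₜA by spatial derivatives; this turns A · 𝓛η into the bracket that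
defines α. -/
lemma gvAlpha_mul (hΩ : IsOpen Ω) (hu : ContDiffOn ℝ 2 (Function.uncurry u) Ω)
    (hA : ContDiffOn ℝ 3 (Function.uncurry A) Ω) (hA0 : ∀ t x, (t, x) ∈ Ω → A t x ≠ 0)
    (hLA : ∀ q ∈ Ω, ∀ i, lieOne u A i q = 0) {q : ℝ × E3} (hq : q ∈ Ω) :
    gvAlpha u A q.1 q.2 = (‖A q.1 q.2‖ ^ 2)⁻¹ * (cmp A 0 q * lieOne u (eta A) 0 q
      + cmp A 1 q * lieOne u (eta A) 1 q + cmp A 2 q * lieOne u (eta A) 2 q) := by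
  have hη := contDiffOn_eta hΩ hA hA0
  have du : DifferentiableAt ℝ (Function.uncurry u) (q.1, q.2) :=
    differentiableAt_uncurry hu hΩ (by norm_num) hq
  have dA : DifferentiableAt ℝ (Function.uncurry A) (q.1, q.2) :=
    differentiableAt_uncurry hA hΩ (by norm_num) hq
  have dη : DifferentiableAt ℝ (Function.uncurry (eta A)) (q.1, q.2) :=
    differentiableAt_uncurry hη hΩ (by norm_num) hq
  have dA' : ∀ i, DifferentiableAt ℝ (cmp A i) q := differentiableAt_euclidean.1 dA
  have dη' : ∀ i, DifferentiableAt ℝ (cmp (eta A) i) q := differentiableAt_euclidean.1 dη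
  have m := fun i => (dA' i).fun_mul (dη' i)
  have orth : dirD timeDir (fun q => cmp A 0 q * cmp (eta A) 0 q
    + cmp A 1 q * cmp (eta A) 1 q + cmp A 2 q * cmp (eta A) 2 q) q = 0 := by
    simp only [inner_A_eta, dirD_const]
  rw [dirD_add ((m 0).fun_add (m 1)) (m 2), dirD_add (m 0) (m 1), dirD_mul (dA' 0) (dη' 0),
    dirD_mul (dA' 1) (dη' 1), dirD_mul (dA' 2) (dη' 2)] at orth
  have l0 := hLA q hq 0
  have l1 := hLA q hq 1
  have l2 := hLA q hq 2
  rw [gvAlpha]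
  congr 1
  simp only [inner_eq, PiLp.add_apply, convect, fderiv_apply_eq dη, fderiv_apply_eq dA,
    gradTransposeMul_apply_eq du, Fin.sum_univ_three]
  simp only [lieOne, cmp, Prod.mk.eta] at *
  linear_combination -orth + eta A q.1 q.2 0 * l0 + eta A q.1 q.2 1 * l1 + eta A q.1 q.2 2 * l2

lemma contDiffOn_gvAlpha (hΩ : IsOpen Ω) (hu : ContDiffOn ℝ 2 (Function.uncurry u) Ω)
    (hA : ContDiffOn ℝ 3 (Function.uncurry A) Ω) (hA0 : ∀ t x, (t, x) ∈ Ω → A t x ≠ 0)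
    (hLA : ∀ q ∈ Ω, ∀ i, lieOne u A i q = 0) :
    ContDiffOn ℝ 1 (Function.uncurry (gvAlpha u A)) Ω := by
  have hη := contDiffOn_eta hΩ hA hA0
  have hA1 : ContDiffOn ℝ 1 (Function.uncurry A) Ω := hA.of_le (by norm_num)
  have hm := fun i => (hA1.cmp i).mul (contDiffOn_lieOne hΩ hu hη i)
  have hN : ContDiffOn ℝ 1 (fun q => (‖Function.uncurry A q‖ ^ 2)⁻¹) Ω :=
    (hA1.norm_sq ℝ).inv fun q hq => by simpa [Function.uncurry] using hA0 q.1 q.2 hq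
  exact (hN.mul (((hm 0).add (hm 1)).add (hm 2))).congr fun q hq =>
    gvAlpha_mul hΩ hu hA hA0 hLA hq

/-- The Godbillon-Vey density of a Lie dragged potential without helicity is conserved. -/
theorem gv_conservation (hΩ : IsOpen Ω) (hu : ContDiffOn ℝ 2 (Function.uncurry u) Ω)
    (hA : ContDiffOn ℝ 3 (Function.uncurry A) Ω) (hA0 : ∀ t x, (t, x) ∈ Ω → A t x ≠ 0)
    (hLA : ∀ q ∈ Ω, ∀ i, lieOne u A i q = 0)
    (hhelicity : ∀ t x, (t, x) ∈ Ω → ⟪A t x, curl (A t) x⟫ = 0) {t : ℝ} {x : E3}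
    (hx : (t, x) ∈ Ω) :
    deriv (fun s => gvDensity A s x) t + divergence (fun y => gvDensity A t y • u t y
      + gvAlpha u A t y • magneticField A t y) x = 0 := by
  have hη := contDiffOn_eta hΩ hA hA0
  have hA2 : ContDiffOn ℝ 2 (Function.uncurry A) Ω := hA.of_le (by norm_num)
  have hα := contDiffOn_gvAlpha hΩ hu hA hA0 hLA
  have hψ := contDiffOn_gvDensity hΩ hA hA0
  have hB := fun q hq k i => vort_eq_wedge hΩ hA hA0 hhelicity (q := q) hq k i
  -- Since 𝓛η is parallel to A, it is its own projection: |A|² 𝓛η = (A · 𝓛η) A.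
  have hLη : ∀ q ∈ Ω, ∀ i, lieOne u (eta A) i q = Function.uncurry (gvAlpha u A) q * cmp A i q := by
    intro q hq i
    have hp := lieOne_wedge hΩ hu hA2 hη hLA hB hq i
    have h : ‖A q.1 q.2‖ ^ 2 ≠ 0 := by simpa using hA0 q.1 q.2 hq
    rw [Function.uncurry, gvAlpha_mul hΩ hu hA hA0 hLA hq]
    have hN := norm_sq_eq (A q.1 q.2)
    have p0 := hp 0
    have p1 := hp 1
    have p2 := hp 2
    rw [mul_assoc, eq_inv_mul_iff_mul_eq₀ h, hN]
    simp only [cmp] at *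
    linear_combination A q.1 q.2 0 * p0 + A q.1 q.2 1 * p1 + A q.1 q.2 2 * p2
  have hψ' : ∀ q ∈ Ω, Function.uncurry (gvDensity A) q = cmp (eta A) 0 q * vort (eta A) 1 2 q
      + cmp (eta A) 1 q * vort (eta A) 2 0 q + cmp (eta A) 2 q * vort (eta A) 0 1 q := by
    intro q hq
    obtain ⟨c0, c1, c2⟩ := curl_eq_vort (t := q.1) (x := q.2)
      (differentiableAt_uncurry hη hΩ (by norm_num) hq)
    rw [Function.uncurry, gvDensity, inner_eq, c0, c1, c2]
    rfl
  have key := conservation_components hΩ hu hA2 hη hα hLη hB hψ' hx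
  have hG : ContDiffOn ℝ 1 (Function.uncurry fun t y => gvDensity A t y • u t y
      + gvAlpha u A t y • magneticField A t y) Ω :=
    (hψ.smul (hu.of_le (by norm_num))).add (hα.smul (contDiffOn_curl hA hΩ (m := 1) (by norm_num)))
  have dG := differentiableAt_uncurry hG hΩ (by norm_num) hx
  have ht : deriv (fun s => gvDensity A s x) t
      = dirD timeDir (Function.uncurry (gvDensity A)) (t, x) :=
    (hasDerivAt_slice (differentiableAt_uncurry hψ hΩ (by norm_num) hx)).deriv
  have hcurl : ∀ q ∈ Ω, curl (A q.1) q.2 0 = vort A 1 2 q ∧ curl (A q.1) q.2 1 = vort A 2 0 q ∧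
      curl (A q.1) q.2 2 = vort A 0 1 q := fun q hq =>
    curl_eq_vort (t := q.1) (x := q.2) (differentiableAt_uncurry hA hΩ (by norm_num) hq)
  rw [divergence, Fin.sum_univ_three, ht]
  have hpd := fun i => pd_eq (w := fun t y => gvDensity A t y • u t y
      + gvAlpha u A t y • magneticField A t y) dG i i
  rw [hpd 0, hpd 1, hpd 2, ← key]
  congr 1
  congr 1
  congr 1
  all_goals
    refine dirD_congr ?_
    filter_upwards [hΩ.mem_nhds hx] with q hq
    obtain ⟨c0, c1, c2⟩ := hcurl q hq
    simp [cmp, Function.uncurry, magneticField, -curl_zero, -curl_one, -curl_two, c0, c1, c2]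

end Conservation

end

end GodbillonVey
namespace GodbillonVey

noncomputable section

/-! ### The divergence theorem near the boundary, by cut-offs -/

section Divergence

variable {f χ ρ : E3 → ℝ} {F G : E3 → E3} {D U V : Set E3} {x p v : E3}

lemma pd_eq_fderiv (hG : DifferentiableAt ℝ G x) (j i : Fin 3) :
    pd G j i x = fderiv ℝ (fun y => G y i) x (EuclideanSpace.single j 1) := by
  have h : HasFDerivAt (fun y => G y i) ((EuclideanSpace.proj i : E3 →L[ℝ] ℝ).comp (fderiv ℝ G x)) x :=
    (EuclideanSpace.proj i : E3 →L[ℝ] ℝ).hasFDerivAt.comp x hG.hasFDerivAt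
  rw [pd, h.fderiv]
  rfl

lemma clm_apply_eq_sum (L : E3 →L[ℝ] ℝ) (a : E3) :
    L a = ∑ i, L (EuclideanSpace.single i 1) * a i := by
  have ha : a = ∑ j, a j • EuclideanSpace.single j (1 : ℝ) := by
    ext k; simp [Finset.sum_apply, Pi.single_apply]
  conv_lhs => rw [ha]
  simp [map_sum, mul_comm]

lemma continuous_pd (hG : ContDiff ℝ 1 G) (j i : Fin 3) : Continuous (pd G j i) := by
  have h : Continuous fun x => fderiv ℝ G x (EuclideanSpace.single j 1) :=
    (hG.continuous_fderiv (by norm_num)).clm_apply continuous_const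
  exact (EuclideanSpace.proj i : E3 →L[ℝ] ℝ).continuous.comp h

lemma continuous_divergence (hG : ContDiff ℝ 1 G) : Continuous (divergence G) :=
  continuous_finsetSum _ fun i _ => continuous_pd hG i i

lemma tsupport_pd_subset (G : E3 → E3) (j i : Fin 3) : tsupport (pd G j i) ⊆ tsupport G := by
  refine closure_minimal (fun x hx => ?_) (isClosed_tsupport G)
  by_contra h
  exact hx (by simp [pd, fderiv_of_notMem_tsupport ℝ h])

lemma divergence_of_notMem_tsupport (hx : x ∉ tsupport G) : divergence G x = 0 := by
  simp [divergence, pd, fderiv_of_notMem_tsupport ℝ hx]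

lemma hasCompactSupport_divergence (hG : HasCompactSupport G) :
    HasCompactSupport (divergence G) :=
  hG.mono' fun x hx => by
    by_contra h
    exact hx (divergence_of_notMem_tsupport h)

/-- Regularity of `f` is required only on the support of `g`, because the cut-offs built from a
local defining function are regular only near the boundary point. -/
lemma continuous_mul_of_tsupport {f g : E3 → ℝ} (hf : ∀ x ∈ tsupport g, ContinuousAt f x)
    (hg : Continuous g) : Continuous fun x => f x * g x :=
  continuous_of_tsupport fun x hx =>
    (hf x (tsupport_mul_subset_right (f := f) hx)).mul hg.continuousAt

lemma integrable_mul_of_tsupport {f g : E3 → ℝ} (hf : ∀ x ∈ tsupport g, ContinuousAt f x)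
    (hg : Continuous g) (hg' : HasCompactSupport g) : Integrable fun x => f x * g x :=
  (continuous_mul_of_tsupport hf hg).integrable_of_hasCompactSupport hg'.mul_left

lemma tsupport_comp_subset (G : E3 → E3) (i : Fin 3) : tsupport (fun x => G x i) ⊆ tsupport G :=
  closure_mono fun x hx h => hx (by simp [h])

/-- Integration by parts against a compactly supported vector field. -/
lemma integral_mul_divergence (hG : ContDiff ℝ 1 G) (hGc : HasCompactSupport G)
    (hf : ∀ x ∈ tsupport G, ContDiffAt ℝ 1 f x) :
    Integrable (fun x => fderiv ℝ f x (G x)) ∧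
      ∫ x, f x * divergence G x = - ∫ x, fderiv ℝ f x (G x) := by
  have hGd : Differentiable ℝ G := hG.differentiable (by norm_num)
  have hGi : ∀ i, ContDiff ℝ 1 fun x => G x i := fun i => contDiff_euclidean.1 hG i
  have hGic : ∀ i, HasCompactSupport fun x => G x i := fun i =>
    hGc.mono' ((subset_tsupport _).trans (tsupport_comp_subset G i))
  have hpc : ∀ i, HasCompactSupport (pd G i i) := fun i =>
    hGc.mono' ((subset_tsupport _).trans (tsupport_pd_subset G i i))
  have hf' : ∀ v : E3, ∀ x ∈ tsupport G, ContinuousAt (fun y => fderiv ℝ f y v) x := fun v x hx =>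
    ((hf x hx).continuousAt_fderiv (by norm_num)).clm_apply continuousAt_const
  have i1 : ∀ i, Integrable fun x => f x * pd G i i x := fun i =>
    integrable_mul_of_tsupport (fun x hx => (hf x (tsupport_pd_subset G i i hx)).continuousAt)
      (continuous_pd hG i i) (hpc i)
  have i2 : ∀ i, Integrable fun x => fderiv ℝ f x (EuclideanSpace.single i 1) * G x i := fun i =>
    integrable_mul_of_tsupport (fun x hx => hf' _ x (tsupport_comp_subset G i hx))
      (hGi i).continuous (hGic i)
  have i3 : ∀ i, Integrable fun x => f x * G x i := fun i =>
    integrable_mul_of_tsupport (fun x hx => (hf x (tsupport_comp_subset G i hx)).continuousAt)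
      (hGi i).continuous (hGic i)
  have e : ∀ i, ∫ x, f x * pd G i i x
      = - ∫ x, fderiv ℝ f x (EuclideanSpace.single i 1) * G x i := fun i => by
    simp only [pd_eq_fderiv (hGd _)]
    refine integral_mul_fderiv_eq_neg_fderiv_mul_of_integrable (i2 i) ?_ (i3 i)
      (fun x hx => (hf x (tsupport_comp_subset G i hx)).differentiableAt (by norm_num))
      fun x _ => (hGi i).differentiable (by norm_num) x
    simpa only [pd_eq_fderiv (hGd _)] using i1 i
  simp only [clm_apply_eq_sum (fderiv ℝ f _) (G _), divergence, Finset.mul_sum]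
  refine ⟨integrable_finsetSum _ fun i _ => i2 i, ?_⟩
  rw [integral_finsetSum _ fun i _ => i1 i, integral_finsetSum _ fun i _ => i2 i,
    Finset.sum_congr rfl fun i _ => e i, Finset.sum_neg_distrib]

lemma integral_divergence_eq_zero (hG : ContDiff ℝ 1 G) (hGc : HasCompactSupport G) :
    ∫ x, divergence G x = 0 := by
  have h := (integral_mul_divergence (f := fun _ => 1) hG hGc fun x _ => contDiffAt_const).2
  simpa using h

lemma contDiff_smul_of_tsupport {n : ℕ∞ω} (hχ : ContDiff ℝ n χ) (hV : IsOpen V)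
    (hχV : tsupport χ ⊆ V) (hF : ContDiffOn ℝ n F V) : ContDiff ℝ n fun x => χ x • F x := by
  rw [contDiff_iff_contDiffAt]
  intro x
  by_cases hx : x ∈ tsupport χ
  · exact hχ.contDiffAt.smul (hF.contDiffAt (hV.mem_nhds (hχV hx)))
  · have h : (fun x => χ x • F x) =ᶠ[𝓝 x] fun _ => 0 := by
      filter_upwards [notMem_tsupport_iff_eventuallyEq.1 hx] with y hy
      simp [hy]
    exact contDiffAt_const.congr_of_eventuallyEq h

/-- A smooth function of `s` that decreases from `1` to `0` on `[-1, 0]`. -/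
def smoothStep (s : ℝ) : ℝ := Real.smoothTransition (-s)

lemma contDiff_smoothStep : ContDiff ℝ 1 smoothStep :=
  Real.smoothTransition.contDiff.comp contDiff_neg

lemma smoothStep_of_nonneg {s : ℝ} (hs : 0 ≤ s) : smoothStep s = 0 :=
  Real.smoothTransition.zero_of_nonpos (by linarith)

lemma smoothStep_of_le {s : ℝ} (hs : s ≤ -1) : smoothStep s = 1 :=
  Real.smoothTransition.one_of_one_le (by linarith)

lemma abs_smoothStep_le (s : ℝ) : |smoothStep s| ≤ 1 :=
  abs_le.2 ⟨neg_one_lt_zero.le.trans (Real.smoothTransition.nonneg _),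
    Real.smoothTransition.le_one _⟩

lemma deriv_smoothStep_nonpos (s : ℝ) : deriv smoothStep s ≤ 0 := by
  have h : Antitone smoothStep := fun a b hab => Real.smoothTransition.monotone (neg_le_neg hab)
  exact h.deriv_nonpos

lemma deriv_smoothStep_of_one_lt_abs {s : ℝ} (hs : 1 < |s|) : deriv smoothStep s = 0 := by
  rcases lt_abs.1 hs with h | h
  · have : smoothStep =ᶠ[𝓝 s] fun _ => 0 := by
      filter_upwards [lt_mem_nhds h] with r hr using smoothStep_of_nonneg (by linarith)
    simp [this.deriv_eq]
  · have : smoothStep =ᶠ[𝓝 s] fun _ => 1 := by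
      filter_upwards [gt_mem_nhds (show s < -1 by linarith)] with r hr
        using smoothStep_of_le (by linarith)
    simp [this.deriv_eq]

lemma hasFDerivAt_smoothStep_comp (n : ℝ) (hρ : DifferentiableAt ℝ ρ x) :
    HasFDerivAt (fun y => smoothStep (n * ρ y))
      ((n * deriv smoothStep (n * ρ x)) • fderiv ℝ ρ x) x := by
  have h1 : HasDerivAt smoothStep (deriv smoothStep (n * ρ x)) (n * ρ x) :=
    (contDiff_smoothStep.differentiable (by norm_num) _).hasDerivAt
  have h2 := h1.comp_hasFDerivAt x (hρ.hasFDerivAt.const_mul n)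
  refine h2.congr_fderiv ?_
  rw [smul_smul, mul_comm]

/-- The divergence theorem near a boundary point, for a vector field tangent to the boundary. -/
lemma setIntegral_divergence_smul_eq_zero_of_tangent (hD : MeasurableSet D) (hV : IsOpen V)
    (hρ : ContDiffOn ℝ 1 ρ V) (hDV : ∀ x ∈ V, (x ∈ D ↔ ρ x < 0)) {c : ℝ} (hc : 0 < c)
    (hv : ∀ x ∈ V, c ≤ fderiv ℝ ρ x v) (hF : ContDiffOn ℝ 1 F V)
    (htan : ∀ x ∈ V, ρ x = 0 → fderiv ℝ ρ x (F x) = 0) (hχ : ContDiff ℝ 1 χ)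
    (hχc : HasCompactSupport χ) (hχV : tsupport χ ⊆ V) (hχ0 : ∀ x, 0 ≤ χ x) :
    ∫ x in D, divergence (fun y => χ y • F y) x = 0 := by
  set G : E3 → E3 := fun y => χ y • F y with hGdef
  -- Comparison field: `v` is uniformly transversal to the level sets of ρ, so integrating by parts
  -- against `H` controls the mass of the gradient of the cut-off.
  set H : E3 → E3 := fun y => χ y • v with hHdef
  have hG : ContDiff ℝ 1 G := contDiff_smul_of_tsupport hχ hV hχV hF
  have hH : ContDiff ℝ 1 H := hχ.smul contDiff_const
  have hGs : tsupport G ⊆ tsupport χ := tsupport_smul_subset_left χ F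
  have hHs : tsupport H ⊆ tsupport χ := tsupport_smul_subset_left χ fun _ => v
  have hGc : HasCompactSupport G := hχc.smul_right
  have hHc : HasCompactSupport H := hχc.smul_right
  have hρ1 : ∀ x ∈ V, ContDiffAt ℝ 1 ρ x := fun x hx => hρ.contDiffAt (hV.mem_nhds hx)
  set h : ℕ → E3 → ℝ := fun n x => smoothStep (n * ρ x) with hhdef
  have hh : ∀ n, ∀ x ∈ V, ContDiffAt ℝ 1 (h n) x := fun n x hx =>
    contDiff_smoothStep.contDiffAt.comp x (contDiffAt_const.mul (hρ1 x hx))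
  have hh' : ∀ n, ∀ x ∈ V, ∀ a, fderiv ℝ (h n) x a
      = (n * deriv smoothStep (n * ρ x)) * fderiv ℝ ρ x a := fun n x hx a => by
    rw [(hasFDerivAt_smoothStep_comp n ((hρ1 x hx).differentiableAt (by norm_num))).fderiv]
    simp
  obtain ⟨iG, eG⟩ : (∀ n, Integrable fun x => fderiv ℝ (h n) x (G x)) ∧
      ∀ n, ∫ x, h n x * divergence G x = - ∫ x, fderiv ℝ (h n) x (G x) :=
    forall_and.1 fun n => integral_mul_divergence hG hGc fun x hx => hh n x (hχV (hGs hx))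
  obtain ⟨iH, eH⟩ : (∀ n, Integrable fun x => fderiv ℝ (h n) x (H x)) ∧
      ∀ n, ∫ x, h n x * divergence H x = - ∫ x, fderiv ℝ (h n) x (H x) :=
    forall_and.1 fun n => integral_mul_divergence hH hHc fun x hx => hh n x (hχV (hHs hx))
  have hdG : Integrable (divergence G) :=
    (continuous_divergence hG).integrable_of_hasCompactSupport (hasCompactSupport_divergence hGc)
  have hdH : Integrable (divergence H) :=
    (continuous_divergence hH).integrable_of_hasCompactSupport (hasCompactSupport_divergence hHc)
  have hzero : ∀ x, x ∉ V → divergence G x = 0 := fun x hx =>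
    divergence_of_notMem_tsupport fun hx' => hx (hχV (hGs hx'))
  have hχx : ∀ x, x ∉ V → χ x = 0 := fun x hx =>
    image_eq_zero_of_notMem_tsupport fun hx' => hx (hχV hx')
  -- Inside `V` the cut-offs converge pointwise to the indicator of `D`; outside `V` the divergence
  -- of `G` vanishes.
  have lim1 : Tendsto (fun n => ∫ x, h n x * divergence G x) atTop
      (𝓝 (∫ x in D, divergence G x)) := by
    rw [← integral_indicator hD]
    refine tendsto_integral_of_dominated_convergence (fun x => |divergence G x|) (fun n => ?_)
      hdG.abs (fun n => ae_of_all _ fun x => ?_) (ae_of_all _ fun x => ?_)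
    · refine (continuous_mul_of_tsupport (fun x hx => (hh n x ?_).continuousAt)
        (continuous_divergence hG)).aestronglyMeasurable
      by_contra hxV
      have hx2 : x ∉ tsupport G := fun hx' => hxV (hχV (hGs hx'))
      have : tsupport (divergence G) ⊆ tsupport G :=
        closure_minimal (fun y hy => by
          by_contra hy'; exact hy (divergence_of_notMem_tsupport hy')) (isClosed_tsupport G)
      exact hx2 (this hx)
    · rw [Real.norm_eq_abs, abs_mul]
      exact mul_le_of_le_one_left (abs_nonneg _) (abs_smoothStep_le _)
    · by_cases hxV : x ∈ V
      · by_cases hxD : x ∈ D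
        · have hneg := (hDV x hxV).1 hxD
          rw [indicator_of_mem hxD]
          refine tendsto_const_nhds.congr' ?_
          have hlim : Tendsto (fun n : ℕ => (n : ℝ) * ρ x) atTop atBot :=
            tendsto_natCast_atTop_atTop.atTop_mul_const_of_neg hneg
          filter_upwards [hlim.eventually (eventually_le_atBot (-1))] with n hn
          simp [hhdef, smoothStep_of_le hn]
        · have hpos : 0 ≤ ρ x := not_lt.1 fun h => hxD ((hDV x hxV).2 h)
          rw [indicator_of_notMem hxD]
          have : ∀ n : ℕ, h n x * divergence G x = 0 := fun n => by
            simp [hhdef, smoothStep_of_nonneg (mul_nonneg n.cast_nonneg hpos)]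
          simp [this]
      · simp [indicator, hzero x hxV]
  set C : ℝ := ∫ x, |divergence H x| with hC
  have hwG : ∀ n x, fderiv ℝ (h n) x (G x)
      = (n * deriv smoothStep (n * ρ x)) * χ x * fderiv ℝ ρ x (F x) := fun n x => by
    by_cases hx : x ∈ V
    · rw [hh' n x hx]; simp [hGdef, mul_assoc]
    · simp [hGdef, hχx x hx]
  have hwH : ∀ n x, fderiv ℝ (h n) x (H x)
      = (n * deriv smoothStep (n * ρ x)) * χ x * fderiv ℝ ρ x v := fun n x => by
    by_cases hx : x ∈ V
    · rw [hh' n x hx]; simp [hHdef, mul_assoc]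
    · simp [hHdef, hχx x hx]
  -- The weight has a constant sign, which is where χ ≥ 0 enters; its mass can then be bounded
  -- without absolute values.
  have hw0 : ∀ (n : ℕ) x, (n * deriv smoothStep (n * ρ x)) * χ x ≤ 0 := fun n x =>
    mul_nonpos_of_nonpos_of_nonneg
      (mul_nonpos_of_nonneg_of_nonpos n.cast_nonneg (deriv_smoothStep_nonpos _)) (hχ0 x)
  have bound : ∀ n, ∫ x, -fderiv ℝ (h n) x (H x) ≤ C := fun n => by
    rw [integral_neg, ← eH n]
    refine (le_abs_self _).trans ((Real.norm_eq_abs _).symm.trans_le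
      ((norm_integral_le_integral_norm _).trans ?_))
    refine integral_mono_of_nonneg (ae_of_all _ fun x => norm_nonneg _) hdH.abs
      (ae_of_all _ fun x => ?_)
    change ‖h n x * divergence H x‖ ≤ |divergence H x|
    rw [Real.norm_eq_abs, abs_mul]
    exact mul_le_of_le_one_left (abs_nonneg _) (abs_smoothStep_le _)
  have lim2 : Tendsto (fun n => ∫ x, h n x * divergence G x) atTop (𝓝 0) := by
    rw [Metric.tendsto_atTop]
    intro ε hε
    have hC0 : 0 ≤ C := integral_nonneg fun x => abs_nonneg _
    -- Chosen so that (δ / c) * C < ε; the `+ 1` covers the case C = 0.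
    set δ : ℝ := c * ε / (2 * (C + 1)) with hδdef
    have hδ : 0 < δ := by positivity
    -- On the compact set `K` where the derivative of ρ along `F` is at least δ in absolute value, ρ
    -- has no zero by tangency, so |ρ| has a positive minimum there.
    obtain ⟨r, hr, hrδ⟩ : ∃ r > 0, ∀ x ∈ tsupport χ, |ρ x| < r → |fderiv ℝ ρ x (F x)| < δ := by
      have hcont : ContinuousOn (fun x => |fderiv ℝ ρ x (F x)|) (tsupport χ) := fun x hx =>
        ((((hρ1 x (hχV hx)).continuousAt_fderiv (by norm_num)).clm_apply
          (hF.contDiffAt (hV.mem_nhds (hχV hx))).continuousAt).abs).continuousWithinAt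
      set K := tsupport χ ∩ (fun x => |fderiv ℝ ρ x (F x)|) ⁻¹' Ici δ with hKdef
      have hmem : ∀ x ∈ tsupport χ, ¬|fderiv ℝ ρ x (F x)| < δ → x ∈ K := fun x hx hx' =>
        ⟨hx, not_lt.1 hx'⟩
      have hK : IsCompact K :=
        hχc.isCompact.of_isClosed_subset
          (hcont.preimage_isClosed_of_isClosed (isClosed_tsupport χ) isClosed_Ici)
          inter_subset_left
      have hcρ : ContinuousOn (fun x => |ρ x|) K := fun x hx =>
        ((hρ1 x (hχV hx.1)).continuousAt.abs).continuousWithinAt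
      rcases eq_empty_or_nonempty K with he | hne
      · refine ⟨1, one_pos, fun x hx _ => ?_⟩
        by_contra hcon
        exact notMem_empty x (he ▸ hmem x hx hcon)
      · obtain ⟨y, hy, hmin⟩ := hK.exists_isMinOn hne hcρ
        refine ⟨|ρ y|, abs_pos.2 fun h0 => ?_, fun x hx hxr => ?_⟩
        · have h2 := hy.2
          simp only [mem_preimage, htan y (hχV hy.1) h0, abs_zero, mem_Ici] at h2
          exact absurd h2 (not_le.2 hδ)
        · by_contra hcon
          exact absurd (hmin (hmem x hx hcon)) (not_le.2 hxr)
    obtain ⟨N, hN⟩ := exists_nat_gt (1 / r)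
    refine ⟨N, fun n hn => ?_⟩
    have hnr : 1 < n * r := by
      have : (N : ℝ) ≤ n := by exact_mod_cast hn
      rw [← div_lt_iff₀ hr]; linarith
    rw [Real.dist_0_eq_abs, eG n, abs_neg]
    -- The weight vanishes unless |ρ| ≤ 1/n < r. There the derivative along `F` is below δ, hence at
    -- most δ/c times the derivative along `v`.
    have hpt : ∀ x, ‖fderiv ℝ (h n) x (G x)‖ ≤ (δ / c) * -fderiv ℝ (h n) x (H x) := fun x => by
      rw [hwG, hwH, Real.norm_eq_abs, abs_mul, abs_of_nonpos (hw0 n x)]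
      by_cases hx : x ∈ tsupport χ
      · by_cases hx1 : 1 < |n * ρ x|
        · simp [deriv_smoothStep_of_one_lt_abs hx1]
        · have hρr : |ρ x| < r := by
            rw [abs_mul, Nat.abs_cast] at hx1
            have hn0 : (0 : ℝ) < n := by
              by_contra h0
              have : (n : ℝ) = 0 := le_antisymm (not_lt.1 h0) n.cast_nonneg
              rw [this] at hnr; linarith
            exact lt_of_mul_lt_mul_left (lt_of_le_of_lt (not_lt.1 hx1) hnr) hn0.le
          have h1 := (hrδ x hx hρr).le
          have h2 : δ ≤ (δ / c) * fderiv ℝ ρ x v := by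
            calc δ = (δ / c) * c := by field_simp
              _ ≤ _ := mul_le_mul_of_nonneg_left (hv x (hχV hx)) (by positivity)
          calc _ ≤ -(n * deriv smoothStep (n * ρ x) * χ x) * ((δ / c) * fderiv ℝ ρ x v) :=
                mul_le_mul_of_nonneg_left (h1.trans h2) (by linarith [hw0 n x])
            _ = _ := by ring
      · simp [image_eq_zero_of_notMem_tsupport hx]
    rw [← Real.norm_eq_abs]
    calc ‖∫ x, fderiv ℝ (h n) x (G x)‖ ≤ ∫ x, ‖fderiv ℝ (h n) x (G x)‖ :=
          norm_integral_le_integral_norm _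
      _ ≤ ∫ x, (δ / c) * -fderiv ℝ (h n) x (H x) :=
          integral_mono (iG n).norm ((iH n).neg.const_mul _) hpt
      _ = (δ / c) * ∫ x, -fderiv ℝ (h n) x (H x) := integral_const_mul _ _
      _ ≤ (δ / c) * C := mul_le_mul_of_nonneg_left (bound n) (by positivity)
      _ = ε * (C / (2 * (C + 1))) := by rw [hδdef]; field_simp
      _ < ε := by
          refine mul_lt_of_lt_one_right hε ?_
          rw [div_lt_one (by positivity)]; linarith
  exact tendsto_nhds_unique lim1 lim2

end Divergence

end

end GodbillonVey
namespace GodbillonVey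

noncomputable section

/-! ### The divergence theorem for tangent fields on a `C¹` region -/

section Region

variable {χ ρ : E3 → ℝ} {F : E3 → E3} {D U : Set E3} {p : E3}

/-- Were p outside the closure of `D`, ρ would be nonnegative near p and have a local minimum there,
contrary to the nonzero derivative. This makes the tangency hypothesis available at every nearby
zero of ρ, not only at the chosen boundary point. -/
lemma mem_frontier_of_fderiv_ne_zero (hD : ∀ᶠ x in 𝓝 p, (x ∈ D ↔ ρ x < 0)) (h0 : ρ p = 0)
    (h : fderiv ℝ ρ p ≠ 0) : p ∈ frontier D := by
  have hp : p ∉ D := fun hp => absurd (hD.self_of_nhds.1 hp) (by simp [h0])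
  refine ⟨?_, fun hi => hp (interior_subset hi)⟩
  by_contra hcl
  refine h (IsLocalMin.fderiv_eq_zero ?_)
  have hnot : ∀ᶠ x in 𝓝 p, x ∉ D := by
    filter_upwards [isClosed_closure.isOpen_compl.mem_nhds hcl] with x hx hxD
      using hx (subset_closure hxD)
  filter_upwards [hD, hnot] with x hx hx'
  rw [h0]
  exact not_lt.1 fun hlt => hx' (hx.2 hlt)

/-- At an interior point the localized field has compact support in `D`, so its divergence
integrates to zero. At a boundary point ρ defines `D` locally, and its gradient at p serves as the
transversal direction; half its squared norm is a lower bound nearby. -/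
lemma exists_nhds_setIntegral_divergence_eq_zero (hD : IsOpen D) (hU : IsOpen U)
    (hDU : closure D ⊆ U) (hF : ContDiffOn ℝ 1 F U)
    (hbd : ∀ p ∈ frontier D, ∃ ρ : E3 → ℝ, IsLocalDefiningFunction D p ρ)
    (htan : ∀ p ∈ frontier D, ∀ n, IsOutwardUnitNormal D p n → ⟪F p, n⟫ = 0)
    (hp : p ∈ closure D) : ∃ V : Set E3, IsOpen V ∧ p ∈ V ∧ V ⊆ U ∧
      ∀ χ : E3 → ℝ, ContDiff ℝ 1 χ → HasCompactSupport χ → tsupport χ ⊆ V → (∀ x, 0 ≤ χ x) →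
        ∫ x in D, divergence (fun y => χ y • F y) x = 0 := by
  by_cases hpD : p ∈ D
  · refine ⟨D, hD, hpD, subset_closure.trans hDU, fun χ hχ hχc hχD _ => ?_⟩
    have hG := contDiff_smul_of_tsupport hχ hD hχD (hF.mono (subset_closure.trans hDU))
    rw [setIntegral_eq_integral_of_forall_compl_eq_zero
      (fun x hx => divergence_of_notMem_tsupport fun hx' =>
        hx (hχD (tsupport_smul_subset_left χ F hx')))]
    exact integral_divergence_eq_zero hG hχc.smul_right
  · have hpf : p ∈ frontier D := ⟨hp, fun hi => hpD (interior_subset hi)⟩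
    obtain ⟨ρ, hρ⟩ := hbd p hpf
    set v := gradient ρ p with hv
    have hpos : 0 < fderiv ℝ ρ p v := by
      rw [← inner_gradient, real_inner_self_eq_norm_sq]
      exact pow_pos (norm_pos_iff.2 hρ.gradient_ne_zero) 2
    set c := fderiv ℝ ρ p v / 2 with hc
    have hlt : ∀ᶠ x in 𝓝 p, c < fderiv ℝ ρ x v :=
      ((hρ.contDiffAt.continuousAt_fderiv (by norm_num)).clm_apply continuousAt_const).eventually
        (lt_mem_nhds (by rw [hc]; linarith))
    have hev : ∀ᶠ x in 𝓝 p, (((x ∈ D ↔ ρ x < 0) ∧ ContDiffAt ℝ 1 ρ x) ∧ c < fderiv ℝ ρ x v)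
        ∧ x ∈ U :=
      ((hρ.mem_iff.and (hρ.contDiffAt.eventually (by simp))).and hlt).and
        (hU.mem_nhds (hDU hp))
    obtain ⟨V, hV, hVo, hpV⟩ := eventually_nhds_iff.1 hev
    refine ⟨V, hVo, hpV, fun x hx => (hV x hx).2, fun χ hχ hχc hχV hχ0 => ?_⟩
    have hcpos : 0 < c := by rw [hc]; linarith
    refine setIntegral_divergence_smul_eq_zero_of_tangent hD.measurableSet hVo
      (fun x hx => (hV x hx).1.1.2.contDiffWithinAt) (fun x hx => (hV x hx).1.1.1) hcpos
      (fun x hx => (hV x hx).1.2.le) (hF.mono fun x hx => (hV x hx).2) (fun x hx h0 => ?_)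
      hχ hχc hχV hχ0
    have hmem : ∀ᶠ y in 𝓝 x, (y ∈ D ↔ ρ y < 0) := by
      filter_upwards [hVo.mem_nhds hx] with y hy using (hV y hy).1.1.1
    have hne : fderiv ℝ ρ x ≠ 0 := fun h => by
      have := (hV x hx).1.2
      rw [h] at this
      simp at this
      linarith
    have hgne : gradient ρ x ≠ 0 := fun h => hne (by
      ext a; rw [← inner_gradient, h]; simp)
    have hn := htan x (mem_frontier_of_fderiv_ne_zero hmem h0 hne) _
      ⟨ρ, ⟨(hV x hx).1.1.2, h0, hgne, hmem⟩, rfl⟩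
    rw [real_inner_smul_right, real_inner_comm, inner_gradient] at hn
    exact (mul_eq_zero.1 hn).resolve_left (inv_ne_zero (norm_ne_zero_iff.2 hgne))

/-- The divergence theorem on a bounded region with `C¹` boundary, for a vector field which is
tangent to the boundary. -/
theorem setIntegral_divergence_eq_zero_of_tangent (hD : IsC1Region D) (hU : IsOpen U)
    (hDU : closure D ⊆ U) (hF : ContDiffOn ℝ 1 F U)
    (htan : ∀ p ∈ frontier D, ∀ n, IsOutwardUnitNormal D p n → ⟪F p, n⟫ = 0) :
    ∫ x in D, divergence F x = 0 := by
  have hK : IsCompact (closure D) := hD.isBounded.isCompact_closure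
  choose! V hVo hpV hVU hV using fun p hp =>
    exists_nhds_setIntegral_divergence_eq_zero (p := p) hD.isOpen hU hDU hF hD.boundary htan hp
  -- The unit balls keep the supports of the partition of unity bounded, hence compact.
  obtain ⟨T, hT, hcover⟩ := hK.elim_nhds_subcover (fun p => V p ∩ Metric.ball p 1)
    fun p hp => inter_mem ((hVo p hp).mem_nhds (hpV p hp)) (Metric.ball_mem_nhds p one_pos)
  obtain ⟨χ, hχ⟩ := SmoothPartitionOfUnity.exists_isSubordinate (modelWithCornersSelf ℝ E3) isClosed_closure
    (s := closure D) (fun p : T => V p ∩ Metric.ball (p : E3) 1)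
    (fun p => (hVo p (hT p p.2)).inter Metric.isOpen_ball)
    (fun x hx => by
      obtain ⟨p, hp, hx'⟩ := mem_iUnion₂.1 (hcover hx)
      exact mem_iUnion.2 ⟨⟨p, hp⟩, hx'⟩)
  have hχ1 : ∀ p, ContDiff ℝ 1 (χ p) := fun p => (χ p).contMDiff.contDiff.of_le (by simp)
  have hχV : ∀ p : T, tsupport (χ p) ⊆ V p := fun p => (hχ p).trans inter_subset_left
  have hχc : ∀ p, HasCompactSupport (χ p) := fun p =>
    Metric.isCompact_of_isClosed_isBounded (isClosed_tsupport _)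
      (Metric.isBounded_ball.subset ((hχ p).trans inter_subset_right))
  have hG : ∀ p : T, ContDiff ℝ 1 fun x => χ p x • F x := fun p =>
    contDiff_smul_of_tsupport (hχ1 p) (hVo p (hT p p.2)) (hχV p) (hF.mono (hVU p (hT p p.2)))
  -- The partition sums to 1 throughout the open set `D`, so no derivatives of the cut-offs survive
  -- in the sum.
  have hsum : ∀ x ∈ D, divergence F x = ∑ p, divergence (fun y => χ p y • F y) x := fun x hx => by
    have hFx : F =ᶠ[𝓝 x] fun y => ∑ p, χ p y • F y := by
      filter_upwards [hD.isOpen.mem_nhds hx] with y hy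
      have h1 := χ.sum_eq_one (subset_closure hy)
      rw [finsum_eq_sum_of_fintype] at h1
      rw [← Finset.sum_smul, h1, one_smul]
    have hd : fderiv ℝ F x = ∑ p, fderiv ℝ (fun y => χ p y • F y) x := by
      rw [hFx.fderiv_eq, fderiv_fun_sum fun p _ => (hG p).differentiable (by norm_num) x]
    simp only [divergence, pd, hd]
    rw [Finset.sum_comm]
    simp
  rw [setIntegral_congr_fun hD.isOpen.measurableSet hsum, integral_finsetSum]
  · exact Finset.sum_eq_zero fun p _ => hV p (hT p p.2) _ (hχ1 p) (hχc p) (hχV p) (χ.nonneg p)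
  · exact fun p _ => ((continuous_divergence (hG p)).integrable_of_hasCompactSupport
      (hasCompactSupport_divergence (hχc p).smul_right)).integrableOn

end Region

end

end GodbillonVey
namespace GodbillonVey

noncomputable section

/-! ### The Jacobian and injectivity of the Lagrangian map -/

section Flow

variable {Ω : Set (ℝ × E3)} {u X Y V : ℝ → E3 → E3} {V' : ℝ → E3 → E3 →L[ℝ] E3} {I : Set ℝ}
  {t₀ t : ℝ} {D D₀ : Set E3} {y : E3}

/-- Exchange of a time derivative with a spatial derivative. -/
lemma hasDerivAt_fderiv_of_hasDerivAt (hI : IsOpen I) (hIc : I.OrdConnected) (hD : IsOpen D)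
    (hY : ∀ t ∈ I, ∀ y ∈ D, HasDerivAt (fun s => Y s y) (V t y) t)
    (hYd : ∀ t ∈ I, ∀ y ∈ D, DifferentiableAt ℝ (Y t) y)
    (hV : ∀ t ∈ I, ∀ y ∈ D, HasFDerivAt (V t) (V' t y) y)
    (hVc : ContinuousOn (Function.uncurry V) (I ×ˢ D))
    (hVc' : ContinuousOn (Function.uncurry V') (I ×ˢ D)) (ht : t ∈ I) (hy : y ∈ D) :
    HasDerivAt (fun s => fderiv ℝ (Y s) y) (V' t y) t := by
  have hcV : ∀ z ∈ D, ContinuousOn (fun s => V s z) I := fun z hz =>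
    hVc.comp (by fun_prop : ContinuousOn (fun s : ℝ => (s, z)) I) fun s hs => ⟨hs, hz⟩
  have hcV' : ∀ z ∈ D, ContinuousOn (fun s => V' s z) I := fun z hz =>
    hVc'.comp (by fun_prop : ContinuousOn (fun s : ℝ => (s, z)) I) fun s hs => ⟨hs, hz⟩
  have hsub : ∀ s ∈ I, uIcc t s ⊆ I := fun s hs => hIc.uIcc_subset ht hs
  obtain ⟨r, hr, hball⟩ := Metric.nhds_basis_closedBall.mem_iff.1 (hD.mem_nhds hy)
  -- No second derivatives of `Y` are assumed: differentiate the integrated equation in space under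
  -- the integral sign, then in time by the fundamental theorem of calculus.
  have key : ∀ s ∈ I, fderiv ℝ (Y s) y = fderiv ℝ (Y t) y + ∫ τ in t..s, V' τ y := by
    intro s hs
    have hint : ∀ z ∈ D, Y s z = Y t z + ∫ τ in t..s, V τ z := fun z hz => by
      rw [intervalIntegral.integral_eq_sub_of_hasDerivAt
        (fun τ hτ => hY τ (hsub s hs hτ) z hz)
        ((hcV z hz).mono (hsub s hs)).intervalIntegrable]
      abel
    obtain ⟨C, hC⟩ := (isCompact_uIcc.prod (isCompact_closedBall y r)).exists_bound_of_continuousOn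
      (hVc'.mono (prod_mono (hsub s hs) hball))
    have hder : HasFDerivAt (fun z => ∫ τ in t..s, V τ z) (∫ τ in t..s, V' τ y) y := by
      refine (intervalIntegral.hasFDerivAt_integral_of_dominated_of_fderiv_le (μ := volume)
        (F := fun z τ => V τ z) (F' := fun z τ => V' τ z) (bound := fun _ => C)
        (Metric.ball_mem_nhds y hr) ?_ ((hcV y hy).mono (hsub s hs)).intervalIntegrable ?_ ?_
        intervalIntegrable_const ?_)
      · filter_upwards [hD.mem_nhds hy] with z hz
        exact (((hcV z hz).mono (hsub s hs)).mono uIoc_subset_uIcc).aestronglyMeasurable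
          measurableSet_uIoc
      · exact (((hcV' y hy).mono (hsub s hs)).mono uIoc_subset_uIcc).aestronglyMeasurable
          measurableSet_uIoc
      · exact ae_of_all _ fun τ hτ z hz =>
          hC (τ, z) ⟨uIoc_subset_uIcc hτ, Metric.ball_subset_closedBall hz⟩
      · exact ae_of_all _ fun τ hτ z hz => hV τ (hsub s hs (uIoc_subset_uIcc hτ)) z
          (hball (Metric.ball_subset_closedBall hz))
    have hEq : Y s =ᶠ[𝓝 y] fun z => Y t z + ∫ τ in t..s, V τ z := by
      filter_upwards [hD.mem_nhds hy] with z hz using hint z hz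
    rw [hEq.fderiv_eq]
    exact ((hYd t ht y hy).hasFDerivAt.add hder).fderiv
  have hEq : (fun s => fderiv ℝ (Y s) y) =ᶠ[𝓝 t] fun s => fderiv ℝ (Y t) y + ∫ τ in t..s, V' τ y := by
    filter_upwards [hI.mem_nhds ht] with s hs using key s hs
  refine HasDerivAt.congr_of_eventuallyEq ?_ hEq
  refine HasDerivAt.const_add _ ?_
  exact intervalIntegral.integral_hasDerivAt_right (by simp)
    ((hcV' y hy).stronglyMeasurableAtFilter hI t ht) ((hcV' y hy).continuousAt (hI.mem_nhds ht))

lemma det_eq (L : E3 →L[ℝ] E3) :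
    L.det = (Matrix.of fun i j => L (EuclideanSpace.single j 1) i : Matrix (Fin 3) (Fin 3) ℝ).det := by
  rw [ContinuousLinearMap.det, ← LinearMap.det_toMatrix (EuclideanSpace.basisFun (Fin 3) ℝ).toBasis]
  congr 1

lemma det_fderiv_eq (F : E3 → E3) (y : E3) :
    (fderiv ℝ F y).det = pd F 0 0 y * pd F 1 1 y * pd F 2 2 y - pd F 0 0 y * pd F 2 1 y * pd F 1 2 y
      - pd F 1 0 y * pd F 0 1 y * pd F 2 2 y + pd F 1 0 y * pd F 2 1 y * pd F 0 2 y
      + pd F 2 0 y * pd F 0 1 y * pd F 1 2 y - pd F 2 0 y * pd F 1 1 y * pd F 0 2 y := by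
  rw [det_eq, Matrix.det_fin_three]
  rfl

namespace IsLagrangianMap

lemma contDiffAt_slice (hX : IsLagrangianMap Ω u I t₀ D₀ X) (ht : t ∈ I) (hy : y ∈ closure D₀) :
    ContDiffAt ℝ 1 (X t) y :=
  ContDiffAt.comp (f := fun z : E3 => (t, z)) (g := Function.uncurry X) y
    (hX.contDiffAt t ht y hy) (by fun_prop)

lemma continuousAt_fderiv (hX : IsLagrangianMap Ω u I t₀ D₀ X) (ht : t ∈ I) (hy : y ∈ closure D₀) :
    ContinuousAt (fun q : ℝ × E3 => fderiv ℝ (X q.1) q.2) (t, y) := by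
  have h := hX.contDiffAt t ht y hy
  have hE : (fun q : ℝ × E3 => fderiv ℝ (X q.1) q.2) =ᶠ[𝓝 (t, y)] fun q =>
      (fderiv ℝ (Function.uncurry X) q).comp (ContinuousLinearMap.inr ℝ ℝ E3) := by
    filter_upwards [h.eventually (by simp)] with q hq
    have hd : HasFDerivAt (X q.1) _ q.2 :=
      hasFDerivAt_slice (G := Function.uncurry X) (hq.differentiableAt (by norm_num))
    exact hd.fderiv
  exact ((h.continuousAt_fderiv (by norm_num)).clm_comp continuousAt_const).congr hE.symm

lemma continuousAt_pd (hX : IsLagrangianMap Ω u I t₀ D₀ X) (ht : t ∈ I) (hy : y ∈ closure D₀)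
    (j i : Fin 3) : ContinuousAt (fun q : ℝ × E3 => pd (X q.1) j i q.2) (t, y) :=
  (EuclideanSpace.proj i : E3 →L[ℝ] ℝ).continuous.continuousAt.comp
    ((hX.continuousAt_fderiv ht hy).clm_apply continuousAt_const)

lemma continuousAt_det (hX : IsLagrangianMap Ω u I t₀ D₀ X) (ht : t ∈ I) (hy : y ∈ closure D₀) :
    ContinuousAt (fun q : ℝ × E3 => (fderiv ℝ (X q.1) q.2).det) (t, y) := by
  have h := hX.continuousAt_pd ht hy
  simp only [det_fderiv_eq]
  exact ((((((h 0 0).mul (h 1 1)).mul (h 2 2)).sub (((h 0 0).mul (h 2 1)).mul (h 1 2))).sub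
    (((h 1 0).mul (h 0 1)).mul (h 2 2))).add (((h 1 0).mul (h 2 1)).mul (h 0 2))).add
    (((h 2 0).mul (h 0 1)).mul (h 1 2)) |>.sub (((h 2 0).mul (h 1 1)).mul (h 0 2))

lemma continuousOn_comp (hX : IsLagrangianMap Ω u I t₀ D₀ X) {F : Type*} [TopologicalSpace F]
    {g : ℝ × E3 → F} (hg : ContinuousOn g Ω) :
    ContinuousOn (fun q : ℝ × E3 => g (q.1, X q.1 q.2)) (I ×ˢ closure D₀) := by
  refine hg.comp (fun q hq => ?_) fun q hq => hX.mem q.1 hq.1 q.2 hq.2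
  exact (continuousAt_fst.prodMk (hX.contDiffAt q.1 hq.1 q.2 hq.2).continuousAt).continuousWithinAt

lemma hasDerivAt_comp (hX : IsLagrangianMap Ω u I t₀ D₀ X) {F : Type*} [NormedAddCommGroup F]
    [NormedSpace ℝ F] {g : ℝ × E3 → F} (ht : t ∈ I) (hy : y ∈ closure D₀)
    (hg : DifferentiableAt ℝ g (t, X t y)) :
    HasDerivAt (fun s => g (s, X s y)) (fderiv ℝ g (t, X t y) (1, u t (X t y))) t :=
  hg.hasFDerivAt.comp_hasDerivAt t ((hasDerivAt_id t).prodMk (hX.hasDerivAt t ht y hy))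

variable (hΩ : IsOpen Ω) (hu : ContDiffOn ℝ 1 (Function.uncurry u) Ω)
  (hI : IsOpen I) (hIc : I.OrdConnected) (hD₀ : IsOpen D₀)

include hΩ hu in
lemma continuousOn_fderiv_velocity :
    ContinuousOn (fun q : ℝ × E3 => fderiv ℝ (u q.1) q.2) Ω := by
  have h : ContinuousOn (fun q => (fderiv ℝ (Function.uncurry u) q).comp
      (ContinuousLinearMap.inr ℝ ℝ E3)) Ω :=
    (hu.continuousOn_fderiv_of_isOpen hΩ (by norm_num)).clm_comp continuousOn_const
  refine h.congr fun q hq => ?_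
  have hd : HasFDerivAt (u q.1) _ q.2 :=
    hasFDerivAt_slice (G := Function.uncurry u) (differentiableAt_uncurry hu hΩ (by norm_num) hq)
  exact hd.fderiv

include hΩ hu hI hIc hD₀ in
-- The linearized flow equation. The map is only `C¹`, but its velocity `u t (X t y)` is itself `C¹`
-- in the label, which suffices for the exchange of derivatives.
lemma hasDerivAt_fderiv (hX : IsLagrangianMap Ω u I t₀ D₀ X) (ht : t ∈ I) (hy : y ∈ D₀) :
    HasDerivAt (fun s => fderiv ℝ (X s) y)
      ((fderiv ℝ (u t) (X t y)).comp (fderiv ℝ (X t) y)) t := by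
  have hsub : I ×ˢ D₀ ⊆ I ×ˢ closure D₀ := prod_mono_right subset_closure
  refine hasDerivAt_fderiv_of_hasDerivAt (V := fun t y => u t (X t y))
    (V' := fun t y => (fderiv ℝ (u t) (X t y)).comp (fderiv ℝ (X t) y)) hI hIc hD₀
    (fun t ht y hy => hX.hasDerivAt t ht y (subset_closure hy))
    (fun t ht y hy => (hX.contDiffAt_slice ht (subset_closure hy)).differentiableAt (by norm_num))
    (fun t ht y hy => ?_) ((hX.continuousOn_comp hu.continuousOn).mono hsub) ?_ ht hy
  · have hd : DifferentiableAt ℝ (u t) (X t y) :=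
      (hasFDerivAt_slice (G := Function.uncurry u) (differentiableAt_uncurry hu hΩ (by norm_num)
        (hX.mem t ht y (subset_closure hy)))).differentiableAt
    exact hd.hasFDerivAt.comp y
      ((hX.contDiffAt_slice ht (subset_closure hy)).differentiableAt (by norm_num)).hasFDerivAt
  · exact ((hX.continuousOn_comp (continuousOn_fderiv_velocity hΩ hu)).mono hsub).clm_comp
      fun q hq => (hX.continuousAt_fderiv hq.1 (subset_closure hq.2)).continuousWithinAt

include hΩ hu hI hIc hD₀ in
lemma hasDerivAt_pd (hX : IsLagrangianMap Ω u I t₀ D₀ X) (ht : t ∈ I) (hy : y ∈ D₀) (j i : Fin 3) :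
    HasDerivAt (fun s => pd (X s) j i y) (∑ k, pd (u t) k i (X t y) * pd (X t) j k y) t := by
  have h1 := ((hX.hasDerivAt_fderiv hΩ hu hI hIc hD₀ ht hy).clm_apply
    (hasDerivAt_const t (EuclideanSpace.single j (1 : ℝ))))
  have h2 := (EuclideanSpace.proj i : E3 →L[ℝ] ℝ).hasFDerivAt.comp_hasDerivAt t h1
  refine h2.congr_deriv ?_
  have h3 := clm_apply_eq_sum ((EuclideanSpace.proj i : E3 →L[ℝ] ℝ).comp (fderiv ℝ (u t) (X t y)))
    (fderiv ℝ (X t) y (EuclideanSpace.single j 1))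
  simpa [pd] using h3

include hΩ hu hI hIc hD₀ in
/-- Liouville's formula. -/
lemma hasDerivAt_det (hX : IsLagrangianMap Ω u I t₀ D₀ X) (ht : t ∈ I) (hy : y ∈ D₀) :
    HasDerivAt (fun s => (fderiv ℝ (X s) y).det)
      (divergence (u t) (X t y) * (fderiv ℝ (X t) y).det) t := by
  have h := hX.hasDerivAt_pd hΩ hu hI hIc hD₀ ht hy
  simp only [det_fderiv_eq]
  have key := ((((((h 0 0).fun_mul (h 1 1)).fun_mul (h 2 2)).fun_sub
    (((h 0 0).fun_mul (h 2 1)).fun_mul (h 1 2))).fun_sub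
    (((h 1 0).fun_mul (h 0 1)).fun_mul (h 2 2))).fun_add
    (((h 1 0).fun_mul (h 2 1)).fun_mul (h 0 2))).fun_add
    (((h 2 0).fun_mul (h 0 1)).fun_mul (h 1 2)) |>.fun_sub
    (((h 2 0).fun_mul (h 1 1)).fun_mul (h 0 2))
  refine key.congr_deriv ?_
  simp only [divergence, Fin.sum_univ_three]
  ring

include hΩ hu in
lemma continuousOn_divergence_velocity (hX : IsLagrangianMap Ω u I t₀ D₀ X) :
    ContinuousOn (fun q : ℝ × E3 => divergence (u q.1) (X q.1 q.2)) (I ×ˢ closure D₀) :=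
  hX.continuousOn_comp (g := fun q => divergence (u q.1) q.2) <|
    continuousOn_finsetSum _ fun i _ => (contDiffOn_pd (m := 0) hu hΩ (by norm_num) i i).continuousOn

include hΩ hu hI hIc hD₀ in
-- Multiplying by the integrating factor in Liouville's formula gives a constant in time, equal to 1
-- at `t₀`, where the map is the identity near y.
lemma det_eq_exp (hX : IsLagrangianMap Ω u I t₀ D₀ X) (ht₀ : t₀ ∈ I) (ht : t ∈ I) (hy : y ∈ D₀) :
    (fderiv ℝ (X t) y).det = Real.exp (∫ s in t₀..t, divergence (u s) (X s y)) := by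
  have hc : ContinuousOn (fun s => divergence (u s) (X s y)) I :=
    (continuousOn_divergence_velocity hΩ hu hX).comp
      (by fun_prop : ContinuousOn (fun s : ℝ => (s, y)) I) fun s hs => ⟨hs, subset_closure hy⟩
  have hint : ∀ s ∈ I, HasDerivAt (fun s => ∫ τ in t₀..s, divergence (u τ) (X τ y))
      (divergence (u s) (X s y)) s := fun s hs =>
    intervalIntegral.integral_hasDerivAt_right
      ((hc.mono (hIc.uIcc_subset ht₀ hs)).intervalIntegrable)
      (hc.stronglyMeasurableAtFilter hI s hs) (hc.continuousAt (hI.mem_nhds hs))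
  have hder : ∀ s ∈ I, HasDerivAt (fun s => (fderiv ℝ (X s) y).det *
      Real.exp (-∫ τ in t₀..s, divergence (u τ) (X τ y))) 0 s := fun s hs => by
    refine ((hX.hasDerivAt_det hΩ hu hI hIc hD₀ hs hy).fun_mul (hint s hs).fun_neg.exp).congr_deriv ?_
    ring
  have hconst := hI.is_const_of_deriv_eq_zero hIc.isPreconnected
    (fun s hs => (hder s hs).differentiableAt.differentiableWithinAt)
    (fun s hs => (hder s hs).deriv) ht ht₀
  have hid : fderiv ℝ (X t₀) y = ContinuousLinearMap.id ℝ E3 := by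
    have : X t₀ =ᶠ[𝓝 y] id := by
      filter_upwards [hD₀.mem_nhds hy] with z hz using hX.initial z (subset_closure hz)
    rw [this.fderiv_eq, fderiv_id]
  have h1 : (ContinuousLinearMap.id ℝ E3).det = 1 := by
    simp [ContinuousLinearMap.det]
  simp only [hid, h1, intervalIntegral.integral_same, neg_zero, Real.exp_zero, mul_one] at hconst
  rwa [Real.exp_neg, mul_inv_eq_one₀ (Real.exp_ne_zero _)] at hconst

include hΩ hu hI hIc hD₀ in
-- The exponential formula holds on the open set `D₀` only. The divergence along trajectories is
-- bounded on compact time intervals, so it yields a uniform positive lower bound on `D₀`, which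
-- continuity extends to the closure.
lemma det_pos (hX : IsLagrangianMap Ω u I t₀ D₀ X) (hb : Bornology.IsBounded D₀) (ht₀ : t₀ ∈ I)
    (ht : t ∈ I) (hy : y ∈ closure D₀) : 0 < (fderiv ℝ (X t) y).det := by
  obtain ⟨C, hC⟩ := (isCompact_uIcc.prod hb.isCompact_closure).exists_bound_of_continuousOn
    ((continuousOn_divergence_velocity hΩ hu hX).mono
      (prod_mono_left (hIc.uIcc_subset ht₀ ht)))
  have hlow : ∀ z ∈ D₀, Real.exp (-(C * |t - t₀|)) ≤ (fderiv ℝ (X t) z).det := fun z hz => by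
    rw [hX.det_eq_exp hΩ hu hI hIc hD₀ ht₀ ht hz, Real.exp_le_exp]
    refine neg_le_of_abs_le ?_
    exact intervalIntegral.norm_integral_le_of_norm_le_const fun s hs =>
      hC (s, z) ⟨uIoc_subset_uIcc hs, subset_closure hz⟩
  have hc : ContinuousOn (fun z => (fderiv ℝ (X t) z).det) (closure D₀) := fun z hz =>
    (ContinuousAt.comp (f := fun z : E3 => (t, z)) (hX.continuousAt_det ht hz)
      (by fun_prop)).continuousWithinAt
  exact (Real.exp_pos _).trans_le (le_on_closure hlow continuousOn_const hc hy)

include hΩ hu hI hIc in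
-- Two trajectories that meet at one time agree nearby, because `u` is locally Lipschitz. The set of
-- times near which they agree is open, and relatively closed in the connected set `I`, so it
-- reaches `t₀`, where the labels are the positions.
lemma injOn (hX : IsLagrangianMap Ω u I t₀ D₀ X) (ht₀ : t₀ ∈ I) (ht : t ∈ I) :
    InjOn (X t) (closure D₀) := by
  intro y hy z hz hyz
  have hloc : ∀ s ∈ I, X s y = X s z → (fun τ => X τ y) =ᶠ[𝓝 s] fun τ => X τ z := by
    intro s hs hsyz
    obtain ⟨K, W, hW, hK⟩ := (hu.contDiffAt (hΩ.mem_nhds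
      (hX.mem s hs y hy))).exists_lipschitzOnWith
    refine ODE_solution_unique_of_eventually (v := u) (s := fun τ => {x | (τ, x) ∈ W}) (K := K)
      (Eventually.of_forall fun τ a ha b hb => ?_) ?_ ?_ hsyz
    · have := hK ha hb
      simpa [Function.uncurry, Prod.edist_eq] using this
    · have hc : ContinuousAt (fun τ => (τ, X τ y)) s :=
        continuousAt_id.prodMk (hX.hasDerivAt s hs y hy).continuousAt
      filter_upwards [hI.mem_nhds hs, hc hW] with τ hτ hτW using ⟨hX.hasDerivAt τ hτ y hy, hτW⟩
    · have hc : ContinuousAt (fun τ => (τ, X τ z)) s :=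
        continuousAt_id.prodMk (hX.hasDerivAt s hs z hz).continuousAt
      rw [hsyz] at hW
      filter_upwards [hI.mem_nhds hs, hc hW] with τ hτ hτW using ⟨hX.hasDerivAt τ hτ z hz, hτW⟩
  have hsub : I ⊆ {s | (fun τ => X τ y) =ᶠ[𝓝 s] fun τ => X τ z} := by
    refine hIc.isPreconnected.subset_of_closure_inter_subset ?_ ⟨t, ht, hloc t ht hyz⟩ ?_
    · exact isOpen_setOfPred_eventually_nhds
    · rintro s ⟨hs, hsI⟩
      refine hloc s hsI ?_
      have hmem : s ∈ closure (I ∩ {τ | X τ y = X τ z}) := by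
        rw [mem_closure_iff_nhds] at hs ⊢
        intro N hN
        obtain ⟨τ, hτ, hτ'⟩ := hs (N ∩ I) (inter_mem hN (hI.mem_nhds hsI))
        exact ⟨τ, hτ.1, hτ.2, Eventually.self_of_nhds hτ'⟩
      have : (𝓝[I ∩ {τ | X τ y = X τ z}] s).NeBot := mem_closure_iff_nhdsWithin_neBot.1 hmem
      have l1 : Tendsto (fun τ => X τ y) (𝓝[I ∩ {τ | X τ y = X τ z}] s) (𝓝 (X s y)) :=
        (hX.hasDerivAt s hsI y hy).continuousAt.tendsto.mono_left nhdsWithin_le_nhds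
      have l2 : Tendsto (fun τ => X τ z) (𝓝[I ∩ {τ | X τ y = X τ z}] s) (𝓝 (X s z)) :=
        (hX.hasDerivAt s hsI z hz).continuousAt.tendsto.mono_left nhdsWithin_le_nhds
      refine tendsto_nhds_unique l1 (l2.congr' ?_)
      filter_upwards [self_mem_nhdsWithin] with τ hτ using hτ.2.symm
  have h0 : X t₀ y = X t₀ z := (hsub ht₀).self_of_nhds
  rwa [hX.initial y hy, hX.initial z hz] at h0

end IsLagrangianMap

end Flow

end

end GodbillonVey
namespace GodbillonVey

noncomputable section

/-! ### Transport of regions and of integrals by the flow -/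

section Transport

variable {Ω : Set (ℝ × E3)} {u A X : ℝ → E3 → E3} {I : Set ℝ} {t₀ t : ℝ} {D D₀ : Set E3} {f : E3 → E3}

lemma closure_image_eq (hb : Bornology.IsBounded D) (hf : ContinuousOn f (closure D)) :
    closure (f '' D) = f '' closure D :=
  (closure_minimal (image_mono subset_closure)
    (hb.isCompact_closure.image_of_continuousOn hf).isClosed).antisymm hf.image_closure

/-- A `C¹` map which is injective on the closure of a region, with invertible derivative there, maps
the region to a region with `C¹` boundary. -/
lemma IsC1Region.image (hD : IsC1Region D) (hf : ∀ y ∈ closure D, ContDiffAt ℝ 1 f y)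
    (hdet : ∀ y ∈ closure D, (fderiv ℝ f y).det ≠ 0) (hinj : InjOn f (closure D)) :
    IsC1Region (f '' D) := by
  have hfc : ContinuousOn f (closure D) := fun y hy => (hf y hy).continuousAt.continuousWithinAt
  have hcl := closure_image_eq hD.isBounded hfc
  have hequiv : ∀ y ∈ closure D, ∃ L : E3 ≃L[ℝ] E3, HasFDerivAt f (L : E3 →L[ℝ] E3) y :=
    fun y hy => ⟨(fderiv ℝ f y).toContinuousLinearEquivOfDetNeZero (hdet y hy), by
      simpa using ((hf y hy).differentiableAt (by norm_num)).hasFDerivAt⟩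
  refine ⟨?_, ?_, ?_⟩
  · rw [isOpen_iff_mem_nhds]
    rintro _ ⟨y, hy, rfl⟩
    obtain ⟨L, hL⟩ := hequiv y (subset_closure hy)
    rw [← ((hf y (subset_closure hy)).hasStrictFDerivAt' hL (by norm_num)).map_nhds_eq_of_equiv]
    exact image_mem_map (hD.isOpen.mem_nhds hy)
  · exact (hD.isBounded.isCompact_closure.image_of_continuousOn hfc).isBounded.subset
      (image_mono subset_closure)
  · intro p hp
    obtain ⟨y, hy, rfl⟩ : p ∈ f '' closure D := hcl ▸ frontier_subset_closure hp
    -- An interior label would give an interior point of the image, since `f` is open near y.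
    have hyf : y ∈ frontier D := by
      refine ⟨hy, fun hi => ?_⟩
      obtain ⟨L, hL⟩ := hequiv y hy
      refine hp.2 (mem_interior_iff_mem_nhds.2 ?_)
      rw [← ((hf y hy).hasStrictFDerivAt' hL (by norm_num)).map_nhds_eq_of_equiv]
      exact image_mem_map (mem_interior_iff_mem_nhds.1 hi)
    obtain ⟨ρ, hρ⟩ := hD.boundary y hyf
    obtain ⟨L, hL⟩ := hequiv y hy
    have hs : HasStrictFDerivAt f (L : E3 →L[ℝ] E3) y :=
      (hf y hy).hasStrictFDerivAt' hL (by norm_num)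
    set g := hs.localInverse f L y with hg
    have hgy : g (f y) = y := hs.localInverse_apply_image
    have hgc : ContDiffAt ℝ 1 g (f y) := (hf y hy).to_localInverse hL (by norm_num)
    have hgd : HasStrictFDerivAt g (L.symm : E3 →L[ℝ] E3) (f y) := hs.to_localInverse
    have hleft : ∀ᶠ z in 𝓝 y, g (f z) = z := hs.eventually_left_inverse
    have hright : ∀ᶠ x in 𝓝 (f y), f (g x) = x := hs.eventually_right_inverse
    have hgt : Tendsto g (𝓝 (f y)) (𝓝 y) := by
      have := hgc.continuousAt.tendsto
      rwa [hgy] at this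
    have hρd : HasFDerivAt (ρ ∘ g) ((fderiv ℝ ρ y).comp (L.symm : E3 →L[ℝ] E3)) (f y) := by
      have h1 : HasFDerivAt ρ (fderiv ℝ ρ y) (g (f y)) := by
        rw [hgy]; exact (hρ.contDiffAt.differentiableAt (by norm_num)).hasFDerivAt
      exact h1.comp (f y) hgd.hasFDerivAt
    -- The defining function of the image is the old one composed with the local inverse.
    refine ⟨ρ ∘ g, ⟨?_, ?_, ?_, ?_⟩⟩
    · refine ContDiffAt.comp (f y) ?_ hgc
      rw [hgy]; exact hρ.contDiffAt
    · simp [hgy, hρ.apply_eq_zero]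
    · intro h0
      refine hρ.gradient_ne_zero ?_
      have h2 : fderiv ℝ ρ y = 0 := by
        ext a
        have h3 : fderiv ℝ (ρ ∘ g) (f y) (L a) = 0 := by
          rw [← inner_gradient, h0, inner_zero_left]
        rw [hρd.fderiv] at h3
        simpa using h3
      rw [gradient, h2, map_zero]
    · obtain ⟨W, hW, hWo, hyW⟩ := eventually_nhds_iff.1 hleft
      -- A point near `f y` could a priori be the image of a distant point of `D`. Global
      -- injectivity and compactness of the closure exclude this, so membership in the image is
      -- decided by `g`.
      have hfar : ∀ᶠ x in 𝓝 (f y), x ∉ f '' (closure D \ W) := by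
        have hcl' : IsClosed (f '' (closure D \ W)) :=
          ((hD.isBounded.isCompact_closure.diff hWo).image_of_continuousOn
            (hfc.mono sdiff_subset)).isClosed
        refine hcl'.isOpen_compl.mem_nhds ?_
        rintro ⟨z, hz, hzy⟩
        exact hz.2 (hinj hz.1 hy hzy ▸ hyW)
      filter_upwards [hfar, hright, hgt.eventually hρ.mem_iff] with x hx1 hx2 hx3
      rw [Function.comp_apply, ← hx3]
      constructor
      · rintro ⟨z, hz, rfl⟩
        have hzW : z ∈ W := by
          by_contra hcon
          exact hx1 ⟨z, ⟨subset_closure hz, hcon⟩, rfl⟩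
        rwa [hW z hzW]
      · exact fun h => ⟨g x, h, hx2⟩

/-- The transport theorem: the integral of a density `ψ` with `∂ₜψ + ∇ · (ψ u + F) = 0` over a
region moving with the fluid is constant, if `F` is tangent to the boundary of the region. -/
theorem hasDerivAt_setIntegral_image (hΩ : IsOpen Ω)
    (hu : ContDiffOn ℝ 1 (Function.uncurry u) Ω) {ψ : ℝ → E3 → ℝ}
    (hψ : ContDiffOn ℝ 1 (Function.uncurry ψ) Ω) {F : ℝ → E3 → E3}
    (hF : ContDiffOn ℝ 1 (Function.uncurry F) Ω)
    (hcons : ∀ t x, (t, x) ∈ Ω →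
      deriv (fun s => ψ s x) t + divergence (fun y => ψ t y • u t y + F t y) x = 0)
    (hI : IsOpen I) (hIc : I.OrdConnected) (ht₀ : t₀ ∈ I) (hD₀ : IsC1Region D₀)
    (hX : IsLagrangianMap Ω u I t₀ D₀ X)
    (htan : ∀ t ∈ I, ∀ p ∈ frontier (X t '' D₀), ∀ n, IsOutwardUnitNormal (X t '' D₀) p n →
      ⟪F t p, n⟫ = 0) (ht : t ∈ I) :
    HasDerivAt (fun s => ∫ x in X s '' D₀, ψ s x) 0 t := by
  have hpos : ∀ s ∈ I, ∀ y ∈ closure D₀, 0 < (fderiv ℝ (X s) y).det := fun s hs y hy =>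
    hX.det_pos hΩ hu hI hIc hD₀.isOpen hD₀.isBounded ht₀ hs hy
  have hinj : ∀ s ∈ I, InjOn (X s) (closure D₀) := fun s hs => hX.injOn hΩ hu hI hIc ht₀ hs
  have hmeas : MeasurableSet D₀ := hD₀.isOpen.measurableSet
  -- Change of variables to the fixed domain; the Jacobian is positive, so the absolute value drops.
  have hchange : ∀ s ∈ I, ∀ h : E3 → ℝ,
      ∫ x in X s '' D₀, h x = ∫ y in D₀, (fderiv ℝ (X s) y).det * h (X s y) := fun s hs h => by
    rw [integral_image_eq_integral_abs_det_fderiv_smul volume hmeas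
      (fun y hy => ((hX.contDiffAt_slice hs (subset_closure hy)).differentiableAt
        (by norm_num)).hasFDerivAt.hasFDerivWithinAt) ((hinj s hs).mono subset_closure)]
    refine setIntegral_congr_fun hmeas fun y hy => ?_
    simp [abs_of_pos (hpos s hs y (subset_closure hy))]
  have hdetc : ContinuousOn (fun q : ℝ × E3 => (fderiv ℝ (X q.1) q.2).det) (I ×ˢ closure D₀) :=
    fun q hq => (hX.continuousAt_det hq.1 hq.2).continuousWithinAt
  have hFc : ContinuousOn (fun q : ℝ × E3 => (fderiv ℝ (X q.1) q.2).det * ψ q.1 (X q.1 q.2))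
      (I ×ˢ closure D₀) := hdetc.mul (hX.continuousOn_comp hψ.continuousOn)
  have hFc' : ContinuousOn (fun q : ℝ × E3 => (fderiv ℝ (X q.1) q.2).det *
      -divergence (F q.1) (X q.1 q.2)) (I ×ˢ closure D₀) := by
    refine hdetc.mul (ContinuousOn.neg (hX.continuousOn_comp (g := fun q => divergence (F q.1) q.2) ?_))
    exact continuousOn_finsetSum _ fun i _ =>
      (contDiffOn_pd (m := 0) hF hΩ (by norm_num) i i).continuousOn
  have hslice : ∀ {g : ℝ × E3 → ℝ}, ContinuousOn g (I ×ˢ closure D₀) → ∀ s ∈ I,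
      ContinuousOn (fun y => g (s, y)) (closure D₀) := fun hg s hs =>
    hg.comp (by fun_prop) fun y hy => ⟨hs, hy⟩
  obtain ⟨r, hr, hball⟩ := Metric.nhds_basis_closedBall.mem_iff.1 (hI.mem_nhds ht)
  obtain ⟨C, hC⟩ := ((isCompact_closedBall t r).prod
    hD₀.isBounded.isCompact_closure).exists_bound_of_continuousOn
      (hFc'.mono (prod_mono_left hball))
  have hfin : volume D₀ ≠ ⊤ := hD₀.isBounded.measure_lt_top.ne
  -- Liouville's formula and the chain rule give J (∂ₜψ + u · ∇ψ + ψ ∇·u), which is -J ∇·F by the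
  -- conservation law.
  have hder : ∀ s ∈ I, ∀ y ∈ D₀, HasDerivAt (fun s => (fderiv ℝ (X s) y).det * ψ s (X s y))
      ((fderiv ℝ (X s) y).det * -divergence (F s) (X s y)) s := by
    intro s hs y hy
    have hmem := hX.mem s hs y (subset_closure hy)
    have dψ := differentiableAt_uncurry hψ hΩ (by norm_num) hmem
    have du := differentiableAt_uncurry hu hΩ (by norm_num) hmem
    have dF := differentiableAt_uncurry hF hΩ (by norm_num) hmem
    have h1 := hX.hasDerivAt_det hΩ hu hI hIc hD₀.isOpen hs hy
    have h2 : HasDerivAt (fun s => ψ s (X s y)) _ s :=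
      hX.hasDerivAt_comp hs (subset_closure hy) dψ
    refine (h1.fun_mul h2).congr_deriv ?_
    have hψt : HasDerivAt (fun τ => ψ τ (X s y)) _ s := hasDerivAt_slice dψ
    have hψx : HasFDerivAt (ψ s) _ (X s y) := hasFDerivAt_slice dψ
    have hux : HasFDerivAt (u s) _ (X s y) := hasFDerivAt_slice du
    have hFx : HasFDerivAt (F s) _ (X s y) := hasFDerivAt_slice dF
    have hc := hcons s (X s y) hmem
    have hsplit : divergence (fun z => ψ s z • u s z + F s z) (X s y)
        = ψ s (X s y) * divergence (u s) (X s y) + fderiv ℝ (ψ s) (X s y) (u s (X s y))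
          + divergence (F s) (X s y) := by
      have hG := ((hψx.differentiableAt.hasFDerivAt.smul hux.differentiableAt.hasFDerivAt).add
        hFx.differentiableAt.hasFDerivAt).fderiv
      have hG' : fderiv ℝ (fun z => ψ s z • u s z + F s z) (X s y) = _ := hG
      rw [clm_apply_eq_sum (fderiv ℝ (ψ s) (X s y))]
      simp only [divergence, pd, hG', Fin.sum_univ_three]
      simp
      ring
    have happ : fderiv ℝ (Function.uncurry ψ) (s, X s y) (1, u s (X s y))
        = deriv (fun τ => ψ τ (X s y)) s + fderiv ℝ (ψ s) (X s y) (u s (X s y)) := by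
      rw [hψt.deriv, hψx.fderiv, ContinuousLinearMap.comp_apply, ← map_add]
      simp
    rw [happ]
    rw [hsplit] at hc
    linear_combination (fderiv ℝ (X s) y).det * hc
  have hmain := (hasDerivAt_integral_of_dominated_loc_of_deriv_le (μ := volume.restrict D₀)
    (F := fun s y => (fderiv ℝ (X s) y).det * ψ s (X s y))
    (F' := fun s y => (fderiv ℝ (X s) y).det * -divergence (F s) (X s y)) (bound := fun _ => C)
    (Metric.ball_mem_nhds t hr) ?_ ?_ ?_ ?_ (integrableOn_const hfin) ?_).2
  · have hz : ∫ y in D₀, (fderiv ℝ (X t) y).det * -divergence (F t) (X t y) = 0 := by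
      -- Back in the moving region, the divergence theorem for tangent fields applies.
      rw [← hchange t ht fun x => -divergence (F t) x, integral_neg, neg_eq_zero]
      have hreg : IsC1Region (X t '' D₀) := hD₀.image (fun y hy => hX.contDiffAt_slice ht hy)
        (fun y hy => (hpos t ht y hy).ne') (hinj t ht)
      have hU : IsOpen {x : E3 | (t, x) ∈ Ω} := hΩ.preimage (by fun_prop)
      refine setIntegral_divergence_eq_zero_of_tangent hreg hU ?_ ?_ (htan t ht)
      · rw [closure_image_eq hD₀.isBounded
          fun y hy => (hX.contDiffAt_slice ht hy).continuousAt.continuousWithinAt]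
        rintro _ ⟨y, hy, rfl⟩
        exact hX.mem t ht y hy
      · exact hF.comp (f := fun x : E3 => (t, x)) (by fun_prop) fun x hx => hx
    rw [hz] at hmain
    refine hmain.congr_of_eventuallyEq ?_
    filter_upwards [hI.mem_nhds ht] with s hs using hchange s hs (ψ s)
  · filter_upwards [hI.mem_nhds ht] with s hs
    exact ((hslice hFc s hs).mono subset_closure).aestronglyMeasurable hmeas
  · exact ((hslice hFc t ht).integrableOn_compact hD₀.isBounded.isCompact_closure).mono_set
      subset_closure
  · exact ((hslice hFc' t ht).mono subset_closure).aestronglyMeasurable hmeas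
  · filter_upwards [ae_restrict_mem hmeas] with y hy s hs
    exact hC (s, y) ⟨Metric.ball_subset_closedBall hs, subset_closure hy⟩
  · filter_upwards [ae_restrict_mem hmeas] with y hy s hs
    exact hder s (hball (Metric.ball_subset_closedBall hs)) y hy

end Transport

end

end GodbillonVey

/-! ### The conservation law and the invariance of the Godbillon–Vey integral -/

theorem mainTheorem3
    (Ω : Set (ℝ × E3)) (hΩ : IsOpen Ω)
    (u A : ℝ → E3 → E3) (φ : ℝ → E3 → ℝ)
    (hu : ContDiffOn ℝ 2 (Function.uncurry u) Ω)
    (hA : ContDiffOn ℝ 3 (Function.uncurry A) Ω)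
    (hA0 : ∀ t x, (t, x) ∈ Ω → A t x ≠ 0)
    (hOhm : GodbillonVey.IdealOhmLaw Ω u φ A)
    (hgauge : ∀ t x, (t, x) ∈ Ω → φ t x = ⟪u t x, A t x⟫)
    (hhelicity : ∀ t x, (t, x) ∈ Ω → ⟪A t x, GodbillonVey.curl (A t) x⟫ = 0) :
    GodbillonVey.IsLieDragged Ω u A ∧
    (ContDiffOn ℝ 1 (Function.uncurry (GodbillonVey.gvDensity A)) Ω ∧
      ContDiffOn ℝ 1 (Function.uncurry (GodbillonVey.gvAlpha u A)) Ω ∧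
      ∀ t x, (t, x) ∈ Ω →
        deriv (fun s => GodbillonVey.gvDensity A s x) t
          + GodbillonVey.divergence (fun y => GodbillonVey.gvDensity A t y • u t y
              + GodbillonVey.gvAlpha u A t y • GodbillonVey.magneticField A t y) x = 0) ∧
    ∀ (I : Set ℝ) (t₀ : ℝ) (D₀ : Set E3) (X : ℝ → E3 → E3),
      IsOpen I → I.OrdConnected → t₀ ∈ I →
      GodbillonVey.IsC1Region D₀ →
      GodbillonVey.IsLagrangianMap Ω u I t₀ D₀ X →
      (∀ t ∈ I, ∀ p ∈ frontier (X t '' D₀), ∀ n : E3,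
        GodbillonVey.IsOutwardUnitNormal (X t '' D₀) p n →
          ⟪GodbillonVey.magneticField A t p, n⟫ = 0) →
      (∀ t ∈ I, IntegrableOn (GodbillonVey.gvDensity A t) (X t '' D₀)) ∧
      (∀ t ∈ I, HasDerivAt (fun s => GodbillonVey.gvIntegral A (X s '' D₀) s) 0 t) ∧
      ∀ s ∈ I, ∀ t ∈ I,
        GodbillonVey.gvIntegral A (X s '' D₀) s = GodbillonVey.gvIntegral A (X t '' D₀) t := by
  have hdrag : GodbillonVey.IsLieDragged Ω u A :=
    GodbillonVey.isLieDragged_of_idealOhmLaw hΩ hOhm hgauge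
  have hLA : ∀ q ∈ Ω, ∀ i, GodbillonVey.lieOne u A i q = 0 := fun q hq i => by
    rw [← GodbillonVey.advectOneForm_apply (t := q.1) (x := q.2)
      (GodbillonVey.differentiableAt_uncurry hu hΩ (by norm_num) hq)
      (GodbillonVey.differentiableAt_uncurry hA hΩ (by norm_num) hq), hdrag q.1 q.2 hq]
    rfl
  have hψ := GodbillonVey.contDiffOn_gvDensity hΩ hA hA0
  have hα := GodbillonVey.contDiffOn_gvAlpha hΩ hu hA hA0 hLA
  have hcons : ∀ t x, (t, x) ∈ Ω → _ := fun t x hx =>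
    GodbillonVey.gv_conservation hΩ hu hA hA0 hLA hhelicity hx
  have hu1 : ContDiffOn ℝ 1 (Function.uncurry u) Ω := hu.of_le (by norm_num)
  have hF : ContDiffOn ℝ 1 (Function.uncurry fun t y =>
      GodbillonVey.gvAlpha u A t y • GodbillonVey.magneticField A t y) Ω :=
    hα.smul (GodbillonVey.contDiffOn_curl hA hΩ (m := 1) (by norm_num))
  refine ⟨hdrag, ⟨hψ, hα, hcons⟩, fun I t₀ D₀ X hI hIc ht₀ hD₀ hX htan => ?_⟩
  have hder : ∀ t ∈ I,
      HasDerivAt (fun s => GodbillonVey.gvIntegral A (X s '' D₀) s) 0 t := fun t ht =>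
    GodbillonVey.hasDerivAt_setIntegral_image hΩ hu1 hψ hF hcons hI hIc ht₀ hD₀ hX
      (fun s hs p hp n hn => by rw [real_inner_smul_left, htan s hs p hp n hn, mul_zero]) ht
  refine ⟨fun t ht => ?_, hder, fun s hs t ht => ?_⟩
  -- The density is continuous on the compact image of the closure of `D₀`, which lies in the time
  -- slice of `Ω`; this gives integrability on the moving region.
  · have hc : ContinuousOn (GodbillonVey.gvDensity A t) (X t '' closure D₀) := by
      refine hψ.continuousOn.comp (f := fun x : E3 => (t, x)) (by fun_prop) ?_
      rintro _ ⟨y, hy, rfl⟩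
      exact hX.mem t ht y hy
    have hK : IsCompact (X t '' closure D₀) :=
      hD₀.isBounded.isCompact_closure.image_of_continuousOn fun y hy =>
        (hX.contDiffAt_slice ht hy).continuousAt.continuousWithinAt
    exact (hc.integrableOn_compact hK).mono_set (image_mono subset_closure)
  · exact hI.is_const_of_deriv_eq_zero hIc.isPreconnected
      (fun r hr => (hder r hr).differentiableAt.differentiableWithinAt)
      (fun r hr => (hder r hr).deriv) hs ht
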